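/- Let $n\ge 0$, let $(W,S)$ be a Coxeter system of type $B_n$ with $S=\{s_1,\dots,s_n\}$, where $m(s_1,s_2)=4$, $m(s_i,s_{i+1})=3$ for $2\le i<n$ and $m(s_i,s_j)=2$ for $|i-j|>1$, and let $(U,T)$ be a Coxeter system of type $A_n$ with $T=\{t_1,\dots,t_n\}$, numbered along the diagram. Let $\Phi_U$ be the root system of $(U,T)$ in its standard geometric representation, and let $\Sigma(\Phi_U)$ be the commutative monoid of root subsystems of $\Phi_U$ (subsets of $\Phi_U$ stable under their own reflections), the product of two subsystems being the subsystem they generate. The group $U$ acts on $\Sigma(\Phi_U)$. Write $\langle t\rangle=\{\alpha_t,-\alpha_t\}$ for $t\in T$. A Juyumaya map $(W,S)\to(U,T)$ is a pair $(\phi,e)$, where $\phi\colon W\to U$ is a group homomorphism and $e\colon S\to\Sigma(\Phi_U)$ is a map such that $\phi(w).e_s=e_{s'}$ whenever $wsw^{-1}=s'$ with $s,s'\in S$, $w\in W$, and such that $e_s\cdot(\phi(w).e_{s'})=e_s\cdot(\phi(sw).e_{s'})$ for all $s,s'\in S$, $w\in W$. **(a)** There is exactly one Juyumaya map $(\phi,e)$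 with $\phi(s_1)=1$, $\phi(s_i)=t_i$ for $2\le i\le n$, and $e_{s_i}=\langle t_i\rangle$ for $i\le 2$. It satisfies $e_{s_i}=\langle t_i\rangle$ for all $i$. Let $R$ be a commutative ring and let $u\colon S\to R^\times$, $s_i\mapsto u_i$, be constant on $W$-conjugacy classes of elements of $S$. Let $\Sigma(\Phi_U)_{[e]}$ be the submonoid of $\Sigma(\Phi_U)$ generated by the elements $\phi(w).e_s$ ($w\in W$, $s\in S$), with the $W$-action $\rho_\phi$ through $\phi$, let $A=R[\Sigma(\Phi_U)_{[e]}]$ be its monoid algebra with the induced $W$-action, and put $\hat e_{s}=1+(u_{s}-1)e_{s}\in A^\times$. Let $B_W$ be the Artin group of $(W,S)$ with standard generators $g_s$, acting on $A$ through $B_W\to W$, and let $$\mathcal E^{(W,S)}(A,\rho_\phi,\hat e)$$ be the quotient of the $R$-algebra $A\rtimes R[B_W]$ (in which $g\,c=(g.c)\,g$ for $g\in B_W$, $c\in A$) by the two-sided ideal generated by the elements $g_s^2-\hat e_s-(1-\hat e_s)g_s$, $s\in S$. In this algebra write $g_i=g_{s_i}$, $e_i=e_{s_i}$, and let $f_1=e_1$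 and $f_i=s_i.f_{i-1}\in\Sigma(\Phi_U)_{[e]}$ for $2\le i\le n$. **(b)** The $R$-algebra $\mathcal E^{(W,S)}(A,\rho_\phi,\hat e)$ is generated by the elements $g_i,e_i,f_i$ ($1\le i\le n$). **(c)** Let $\mathcal E^B_n$ be Flores' type $B$ braids and ties algebra, that is, the $R$-algebra generated by $g_i,e_i,f_i$ ($1\le i\le n$) subject to the relations (for all indices in $\{1,\dots,n\}$ satisfying the stated conditions) \begin{align*} g_ig_j&=g_jg_i && |i-j|>1\\ g_1g_2g_1g_2&=g_2g_1g_2g_1\\ g_ig_jg_i&=g_jg_ig_j && |i-j|=1,\ \{i,j\}\ne\{1,2\}\\ g_i^2&=1+(u_i-1)e_i(1-g_i)\\ g_ie_j&=e_jg_i && |i-j|\ne1\ \text{or}\ (i,j)=(1,2)\\ g_jg_ie_j&=e_ig_jg_i && |i-j|=1,\ \{i,j\}\neq\{1,2\}\\ e_ie_j&=e_je_i\\ e_i^2&=e_i\\ e_je_ig_j&=e_ig_je_i=g_je_ie_j && |i-j|=1,\ \{i,j\}\neq\{1,2\}\\ e_1e_2g_2&=e_2g_2e_1=g_2e_1e_2\\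 f_1&=e_1\\ g_if_j&=f_jg_i && i=1,\ \text{or}\ i\ge2\ \text{and}\ j\ne i-1,i\\ e_if_j&=f_je_i\\ f_if_j&=f_jf_i\\ g_if_{i-1}&=f_ig_i && 2\le i\le n\\ g_if_i&=f_{i-1}g_i && 2\le i\le n\\ e_{i+1}f_i&=e_{i+1}f_{i+1} && 1\le i<n\\ e_{i+1}f_i&=f_{i+1}f_i && 1\le i<n. \end{align*} There is an isomorphism of $R$-algebras $\mathcal E^{(W,S)}(A,\rho_\phi,\hat e)\cong\mathcal E^B_n$ that sends $g_i\mapsto g_i$, $e_i\mapsto e_i$, $f_i\mapsto f_i$ for all $i$. -/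

import Mathlib

/-! # Marin rings, Juyumaya maps and the type `B` braids and ties algebra -/

noncomputable section

namespace BraidsTies

universe u v w x y

/-! ## The geometric representation of a Coxeter group and its root system -/

section Geometric

variable {B : Type u} (M : CoxeterMatrix B)

/-- The Tits form of a Coxeter matrix on the real vector space with basis `(α_s)`, namely
`⟨α_s, α_t⟩ = -cos (π / m(s,t))`. An infinite bond is encoded by `M s t = 0`, and then the
convention `π / 0 = 0` gives the usual value `-1`. -/
def titsForm : (B →₀ ℝ) →ₗ[ℝ] (B →₀ ℝ) →ₗ[ℝ] ℝ :=
  Finsupp.linearCombination ℝ fun s : B =>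
    Finsupp.linearCombination ℝ fun t : B => -Real.cos (Real.pi / (M s t : ℝ))

/-- The simple root attached to a generator. -/
def simpleRoot (s : B) : B →₀ ℝ := Finsupp.single s 1

theorem titsForm_simpleRoot (s t : B) :
    titsForm M (simpleRoot s) (simpleRoot t) = -Real.cos (Real.pi / (M s t : ℝ)) := by
  simp [titsForm, simpleRoot]

theorem titsForm_comm (v v' : B →₀ ℝ) : titsForm M v v' = titsForm M v' v := by
  have h : titsForm M = (titsForm M).flip := by
    ext s t
    have h1 := titsForm_simpleRoot M s t
    have h2 := titsForm_simpleRoot M t s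
    rw [M.symmetric t s] at h2
    simpa [simpleRoot] using h1.trans h2.symm
  exact congrArg (fun f : (B →₀ ℝ) →ₗ[ℝ] (B →₀ ℝ) →ₗ[ℝ] ℝ => f v v') h

/-- The reflection `σ_α` in a unit vector `α`. -/
def reflect (α v : B →₀ ℝ) : B →₀ ℝ := v - (2 * titsForm M α v) • α

theorem two_smul_titsForm_self (s : B) :
    ((2 : ℝ) • titsForm M (simpleRoot s)) (simpleRoot s) = 2 := by
  simp [titsForm_simpleRoot]

/-- The reflection in a simple root, as a linear automorphism. -/
def simpleReflection (s : B) : (B →₀ ℝ) ≃ₗ[ℝ] (B →₀ ℝ) :=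
  Module.reflection (two_smul_titsForm_self M s)

theorem simpleReflection_apply (s : B) (v : B →₀ ℝ) :
    simpleReflection M s v = reflect M (simpleRoot s) v := by
  simp [simpleReflection, reflect, Module.reflection_apply]

open Polynomial.Chebyshev in
theorem simpleReflection_isLiftable : M.IsLiftable (simpleReflection M) := by
  intro s t
  rcases eq_or_ne s t with rfl | hst
  · have h : simpleReflection M s * simpleReflection M s = 1 := by
      ext1 v
      exact Module.involutive_reflection (two_smul_titsForm_self M s) v
    rw [h, one_pow]
  ext1 v
  rcases Nat.eq_zero_or_pos (M s t) with h0 | hpos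
  · rw [h0, pow_zero]
  have hne1 : M s t ≠ 1 := M.off_diagonal s t hst
  set c : ℝ := Real.cos (Real.pi / (M s t : ℝ)) with hc
  have h1 : ((2 : ℝ) • titsForm M (simpleRoot s)) (simpleRoot t) = -2 * c := by
    simp [titsForm_simpleRoot, hc]
  have h2 : ((2 : ℝ) • titsForm M (simpleRoot t)) (simpleRoot s) = -2 * c := by
    simp [titsForm_simpleRoot, hc, M.symmetric t s]
  have key := Module.reflection_mul_reflection_pow_apply (two_smul_titsForm_self M s)
    (two_smul_titsForm_self M t) (M s t) v
  change ((Module.reflection (two_smul_titsForm_self M s) *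
    Module.reflection (two_smul_titsForm_self M t)) ^ (M s t)) v = v
  rw [key, h1, h2]
  clear key
  rcases eq_or_ne (M s t) 2 with hm2 | hm2
  · have hc0 : c = 0 := by rw [hc, hm2]; simp
    rw [hm2, hc0]
    norm_num
    abel
  have hm3 : 3 ≤ M s t := by omega
  have hm3' : (3 : ℝ) ≤ (M s t : ℝ) := by exact_mod_cast hm3
  set θ : ℝ := 2 * Real.pi / (M s t : ℝ) with hθ
  have ht : (-2 * c * (-2 * c) - 2 : ℝ) = 2 * Real.cos θ := by
    have : θ = 2 * (Real.pi / (M s t : ℝ)) := by rw [hθ]; ring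
    rw [this, Real.cos_two_mul, ← hc]; ring
  have hsin : Real.sin θ ≠ 0 := by
    apply ne_of_gt
    apply Real.sin_pos_of_pos_of_lt_pi
    · have := Real.pi_pos
      positivity
    · rw [hθ, div_lt_iff₀ (by linarith)]
      nlinarith [Real.pi_pos]
  rw [ht]
  have hS : ∀ k : ℤ, (S ℝ k).eval (2 * Real.cos θ) = Real.sin ((k + 1) * θ) / Real.sin θ := by
    intro k
    rw [eq_div_iff hsin]
    exact S_two_mul_real_cos θ k
  have hmθ : (M s t : ℝ) * θ = 2 * Real.pi := by
    rw [hθ]; field_simp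
  rcases Nat.even_or_odd' (M s t) with ⟨k, hk | hk⟩
  · have hkθ : (k : ℝ) * θ = Real.pi := by
      rw [hk] at hmθ; push_cast at hmθ; linarith
    have e1 : (((M s t : ℕ) : ℤ) - 2) / 2 = (k : ℤ) - 1 := by omega
    have e2 : (((M s t : ℕ) : ℤ) - 1) / 2 = (k : ℤ) - 1 := by omega
    have hz : (S ℝ ((k : ℤ) - 1)).eval (2 * Real.cos θ) = 0 := by
      rw [hS]; push_cast; rw [sub_add_cancel, hkθ]; simp
    rw [e1, e2, hz]
    simp
  · have e1 : (((M s t : ℕ) : ℤ) - 3) / 2 = (k : ℤ) - 1 := by omega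
    have e2 : (((M s t : ℕ) : ℤ) - 1) / 2 = (k : ℤ) := by omega
    have e3 : (((M s t : ℕ) : ℤ) - 2) / 2 = (k : ℤ) - 1 := by omega
    have e4 : ((M s t : ℕ) : ℤ) / 2 = (k : ℤ) := by omega
    have hz : (S ℝ (k : ℤ)).eval (2 * Real.cos θ) +
        (S ℝ ((k : ℤ) - 1)).eval (2 * Real.cos θ) = 0 := by
      rw [hS, hS]
      push_cast
      have : ((k : ℝ) + 1) * θ = 2 * Real.pi - (k : ℝ) * θ := by
        rw [hk] at hmθ; push_cast at hmθ; linarith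
      rw [sub_add_cancel, this, Real.sin_two_pi_sub]
      ring
    rw [e1, e2, e3, e4, hz]
    simp

variable {M} {W : Type v} [Group W] (cs : CoxeterSystem M W)

/-- The standard geometric representation of a Coxeter system. -/
def geomRep : W →* ((B →₀ ℝ) ≃ₗ[ℝ] (B →₀ ℝ)) :=
  cs.lift ⟨simpleReflection M, simpleReflection_isLiftable M⟩

theorem geomRep_simple (s : B) : geomRep cs (cs.simple s) = simpleReflection M s :=
  cs.lift_apply_simple (simpleReflection_isLiftable M) s

theorem titsForm_geomRep (g : W) (v v' : B →₀ ℝ) :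
    titsForm M (geomRep cs g v) (geomRep cs g v') = titsForm M v v' := by
  induction g using cs.simple_induction_left generalizing v v' with
  | one => simp
  | mul_simple_left g s ih =>
    rw [map_mul, LinearEquiv.mul_apply, LinearEquiv.mul_apply, geomRep_simple,
      simpleReflection_apply, simpleReflection_apply, ← ih v v']
    have h := titsForm_simpleRoot M s s
    have hc := titsForm_comm M (geomRep cs g v) (simpleRoot s)
    simp only [reflect, map_sub, map_smul, LinearMap.sub_apply, LinearMap.smul_apply, smul_eq_mul,
      h, hc, M.diagonal, Nat.cast_one, div_one, Real.cos_pi]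
    ring

theorem geomRep_reflect (g : W) (α v : B →₀ ℝ) :
    geomRep cs g (reflect M α v) = reflect M (geomRep cs g α) (geomRep cs g v) := by
  simp [reflect, titsForm_geomRep]

/-- The root system `Φ` of a Coxeter system: the orbit of the simple roots. -/
def roots : Set (B →₀ ℝ) := {α | ∃ (g : W) (s : B), geomRep cs g (simpleRoot s) = α}

theorem simpleRoot_mem_roots (s : B) : simpleRoot s ∈ roots cs := ⟨1, s, by simp⟩

theorem geomRep_mem_roots (g : W) {α : B →₀ ℝ} (h : α ∈ roots cs) :
    geomRep cs g α ∈ roots cs := by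
  obtain ⟨g', s, rfl⟩ := h
  exact ⟨g * g', s, by simp⟩

theorem reflect_mem_roots {α β : B →₀ ℝ} (hα : α ∈ roots cs) (hβ : β ∈ roots cs) :
    reflect M α β ∈ roots cs := by
  obtain ⟨g, s, rfl⟩ := hα
  have h : reflect M (geomRep cs g (simpleRoot s)) β =
      geomRep cs (g * cs.simple s * g⁻¹) β := by
    have h1 : β = geomRep cs g (geomRep cs g⁻¹ β) := by
      rw [← LinearEquiv.mul_apply, ← map_mul]; simp
    conv_lhs => rw [h1, ← geomRep_reflect, ← simpleReflection_apply, ← geomRep_simple cs]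
    simp [LinearEquiv.mul_apply]
  rw [h]
  exact geomRep_mem_roots cs _ hβ

/-! ## The monoid of root subsystems -/

/-- A root subsystem of `Φ`: a set of roots that is stable under its own reflections. -/
@[ext]
structure RootSubsystem where
  carrier : Set (B →₀ ℝ)
  subset_roots : carrier ⊆ roots cs
  reflect_mem : ∀ α ∈ carrier, ∀ β ∈ carrier, reflect M α β ∈ carrier

namespace RootSubsystem

variable {cs}

/-- The root subsystem generated by a set of roots. (Vectors of `X` that are not roots would be
ignored; the definition is used only for `X ⊆ Φ`.) -/
def generated (cs : CoxeterSystem M W) (X : Set (B →₀ ℝ)) : RootSubsystem cs where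
  carrier := {α | α ∈ roots cs ∧ ∀ Ψ : RootSubsystem cs, X ∩ roots cs ⊆ Ψ.carrier → α ∈ Ψ.carrier}
  subset_roots := fun _ h => h.1
  reflect_mem := fun α hα β hβ => ⟨reflect_mem_roots cs hα.1 hβ.1, fun Ψ hΨ =>
    Ψ.reflect_mem α (hα.2 Ψ hΨ) β (hβ.2 Ψ hΨ)⟩

theorem generated_subset_iff {X : Set (B →₀ ℝ)} (hX : X ⊆ roots cs) (Ψ : RootSubsystem cs) :
    (generated cs X).carrier ⊆ Ψ.carrier ↔ X ⊆ Ψ.carrier :=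
  ⟨fun h _ hα => h ⟨hX hα, fun _ hΨ' => hΨ' ⟨hα, hX hα⟩⟩,
    fun h _ hα => hα.2 Ψ (Set.inter_subset_left.trans h)⟩

/-- The product of two root subsystems is the root subsystem that they generate. -/
instance : Mul (RootSubsystem cs) := ⟨fun Ψ Ψ' => generated cs (Ψ.carrier ∪ Ψ'.carrier)⟩

/-- The empty root subsystem is the unit. -/
instance : One (RootSubsystem cs) :=
  ⟨⟨∅, Set.empty_subset _, fun _ h => absurd h (Set.notMem_empty _)⟩⟩

theorem mul_subset_iff (Ψ Ψ' Θ : RootSubsystem cs) :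
    (Ψ * Ψ').carrier ⊆ Θ.carrier ↔ Ψ.carrier ⊆ Θ.carrier ∧ Ψ'.carrier ⊆ Θ.carrier :=
  (generated_subset_iff (Set.union_subset Ψ.subset_roots Ψ'.subset_roots) Θ).trans
    Set.union_subset_iff

theorem eq_of_forall_subset_iff {Ψ Ψ' : RootSubsystem cs}
    (h : ∀ Θ : RootSubsystem cs, Ψ.carrier ⊆ Θ.carrier ↔ Ψ'.carrier ⊆ Θ.carrier) : Ψ = Ψ' :=
  RootSubsystem.ext (Set.Subset.antisymm ((h Ψ').2 subset_rfl) ((h Ψ).1 subset_rfl))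

instance : CommMonoid (RootSubsystem cs) where
  mul_assoc Ψ Ψ' Ψ'' := eq_of_forall_subset_iff fun Θ => by simp only [mul_subset_iff, and_assoc]
  mul_comm Ψ Ψ' := eq_of_forall_subset_iff fun Θ => by simp only [mul_subset_iff, and_comm]
  one_mul Ψ := eq_of_forall_subset_iff fun Θ => by
    rw [mul_subset_iff]; exact ⟨And.right, fun h => ⟨Set.empty_subset _, h⟩⟩
  mul_one Ψ := eq_of_forall_subset_iff fun Θ => by
    rw [mul_subset_iff]; exact ⟨And.left, fun h => ⟨h, Set.empty_subset _⟩⟩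

theorem mul_self (Ψ : RootSubsystem cs) : Ψ * Ψ = Ψ :=
  eq_of_forall_subset_iff fun Θ => by simp only [mul_subset_iff, and_self]

/-- The action of the Coxeter group on root subsystems. -/
instance : SMul W (RootSubsystem cs) where
  smul g Ψ :=
    { carrier := geomRep cs g '' Ψ.carrier
      subset_roots := by
        rintro _ ⟨α, hα, rfl⟩
        exact geomRep_mem_roots cs g (Ψ.subset_roots hα)
      reflect_mem := by
        rintro _ ⟨α, hα, rfl⟩ _ ⟨β, hβ, rfl⟩
        exact ⟨_, Ψ.reflect_mem α hα β hβ, geomRep_reflect cs g α β⟩ }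

theorem smul_carrier (g : W) (Ψ : RootSubsystem cs) :
    (g • Ψ).carrier = geomRep cs g '' Ψ.carrier := rfl

instance : MulAction W (RootSubsystem cs) where
  one_smul Ψ := RootSubsystem.ext (by simp [smul_carrier])
  mul_smul g h Ψ := RootSubsystem.ext (by
    rw [smul_carrier, smul_carrier, smul_carrier, Set.image_image, map_mul]
    rfl)

theorem smul_subset_iff (g : W) (Ψ Θ : RootSubsystem cs) :
    (g • Ψ).carrier ⊆ Θ.carrier ↔ Ψ.carrier ⊆ (g⁻¹ • Θ).carrier := by
  have h : ∀ (k : W) (Ψ₁ Ψ₂ : RootSubsystem cs), Ψ₁.carrier ⊆ Ψ₂.carrier →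
      (k • Ψ₁).carrier ⊆ (k • Ψ₂).carrier := fun k _ _ => Set.image_mono
  constructor
  · intro h1
    simpa using h g⁻¹ _ _ h1
  · intro h1
    simpa using h g _ _ h1

instance : MulDistribMulAction W (RootSubsystem cs) where
  smul_mul g Ψ Ψ' := eq_of_forall_subset_iff fun Θ => by
    rw [mul_subset_iff, smul_subset_iff, smul_subset_iff, smul_subset_iff, mul_subset_iff]
  smul_one g := RootSubsystem.ext (Set.image_empty _)

end RootSubsystem

/-- The root subsystem `⟨s⟩ = {α_s, -α_s}` attached to a generator. -/
def rankOne (s : B) : RootSubsystem cs := RootSubsystem.generated cs {simpleRoot s}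

end Geometric

/-! ## Artin groups and Marin rings -/

section Marin

variable {B : Type u} {M : CoxeterMatrix B} {W : Type v} [Group W]

/-- The Artin (braid) group of a Coxeter matrix: one generator for each `s`, and for all `s, t` with
`m(s,t)` finite, the braid relation `⋯ s t = ⋯ t s` (`m(s,t)` letters on each side). For
`m(s,t) = ∞`, encoded by `0`, both words are empty. -/
def ArtinGroup (M : CoxeterMatrix B) : Type u :=
  PresentedGroup {r : FreeGroup B | ∃ s t : B,
    r = ((CoxeterSystem.alternatingWord s t (M s t)).map FreeGroup.of).prod *
      ((CoxeterSystem.alternatingWord t s (M s t)).map FreeGroup.of).prod⁻¹}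

instance (M : CoxeterMatrix B) : Group (ArtinGroup M) :=
  inferInstanceAs (Group (PresentedGroup _))

/-- The standard generators of the Artin group. -/
def ArtinGroup.gen (M : CoxeterMatrix B) (s : B) : ArtinGroup M := PresentedGroup.of s

/-- The canonical projection from the Artin group to the Coxeter group. -/
def ArtinGroup.proj (cs : CoxeterSystem M W) : ArtinGroup M →* W :=
  PresentedGroup.toGroup (f := cs.simple) (by
    rintro _ ⟨s, t, rfl⟩
    have h := cs.wordProd_braidWord_eq s t
    rw [CoxeterSystem.braidWord, CoxeterSystem.braidWord, M.symmetric t s] at h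
    simp only [CoxeterSystem.wordProd] at h
    have hl : ∀ l : List B, FreeGroup.lift cs.simple (l.map FreeGroup.of).prod =
        (l.map cs.simple).prod := by
      intro l
      rw [map_list_prod, List.map_map]
      congr 1
      exact List.map_congr_left fun a _ => by simp
    rw [map_mul, map_inv, hl, hl, h, mul_inv_cancel])

theorem ArtinGroup.proj_gen (cs : CoxeterSystem M W) (s : B) :
    ArtinGroup.proj cs (ArtinGroup.gen M s) = cs.simple s :=
  PresentedGroup.toGroup.of _

/-- A Marin datum over the ground ring `k`: an action of `W` on a commutative `k`-algebra `A`
by algebra automorphisms, and a `W`-equivariant map `a : S → Aˣ`. -/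
structure MarinDatum (k : Type w) (cs : CoxeterSystem M W) (A : Type x)
    [CommRing k] [CommRing A] [Algebra k A] where
  ρ : W →* (A ≃ₐ[k] A)
  a : B → Aˣ
  equivariant : ∀ (g : W) (s t : B), g * cs.simple s * g⁻¹ = cs.simple t →
    ρ g (a s : A) = (a t : A)

namespace MarinDatum

variable {k : Type w} {cs : CoxeterSystem M W} {A : Type x} [CommRing k] [CommRing A] [Algebra k A]
variable (D : MarinDatum k cs A)

/-- The action of the Artin group on `A` through the projection to `W`. -/
@[reducible]
def artinAction : MulSemiringAction (ArtinGroup M) A :=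
  MulSemiringAction.compHom A (D.ρ.comp (ArtinGroup.proj cs))

/-- The semidirect product `A ⋊ k[B_W]`: the free left `A`-module on the Artin group, with
`(c g) (c' g') = c (g . c') g g'`. -/
def Semidirect (_ : MarinDatum k cs A) : Type (max x u) := SkewMonoidAlgebra A (ArtinGroup M)

instance : Ring D.Semidirect :=
  letI := D.artinAction
  inferInstanceAs (Ring (SkewMonoidAlgebra A (ArtinGroup M)))

instance : Module k D.Semidirect :=
  inferInstanceAs (Module k (SkewMonoidAlgebra A (ArtinGroup M)))

/-- The element `c g` of `A ⋊ k[B_W]`. -/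
def single (g : ArtinGroup M) (c : A) : D.Semidirect := SkewMonoidAlgebra.single g c

theorem single_mul_single (g g' : ArtinGroup M) (c c' : A) :
    D.single g c * D.single g' c' =
      D.single (g * g') (c * D.ρ (ArtinGroup.proj cs g) c') := by
  let := D.artinAction
  exact SkewMonoidAlgebra.single_mul_single

theorem smul_single (r : k) (g : ArtinGroup M) (c : A) :
    r • D.single g c = D.single g (r • c) :=
  SkewMonoidAlgebra.smul_single r g c

theorem semidirect_induction {p : D.Semidirect → Prop} (z : D.Semidirect)
    (single : ∀ g c, p (D.single g c)) (add : ∀ z z', p z → p z' → p (z + z')) : p z :=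
  SkewMonoidAlgebra.induction_on' z single add

instance : Algebra k D.Semidirect :=
  Algebra.ofModule
    (fun r z z' => by
      induction z using D.semidirect_induction with
      | single g c =>
        induction z' using D.semidirect_induction with
        | single g' c' => simp only [smul_single, single_mul_single, smul_mul_assoc]
        | add z z' h h' => simp only [mul_add, smul_add, h, h']
      | add z₁ z₂ h h' => simp only [add_mul, smul_add, h, h'])
    (fun r z z' => by
      induction z using D.semidirect_induction with
      | single g c =>
        induction z' using D.semidirect_induction with
        | single g' c' => simp only [smul_single, single_mul_single, map_smul, mul_smul_comm]
        | add z z' h h' => simp only [mul_add, smul_add, h, h']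
      | add z₁ z₂ h h' => simp only [add_mul, smul_add, h, h'])

/-- The relations `g_s² = a_s + (1 - a_s) g_s`. -/
inductive HeckeRel : D.Semidirect → D.Semidirect → Prop
  | quadratic (s : B) : HeckeRel
      (D.single (ArtinGroup.gen M s) 1 * D.single (ArtinGroup.gen M s) 1)
      (D.single 1 (D.a s : A) + D.single 1 (1 - (D.a s : A)) * D.single (ArtinGroup.gen M s) 1)

/-- The Marin ring `𝓔(A, ρ, a)`: the quotient of `A ⋊ k[B_W]` by the two-sided ideal generated by
the elements `g_s² - a_s - (1 - a_s) g_s`. -/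
def MarinRing : Type (max x u) := RingQuot D.HeckeRel

instance : Ring D.MarinRing := inferInstanceAs (Ring (RingQuot D.HeckeRel))

instance : Algebra k D.MarinRing := inferInstanceAs (Algebra k (RingQuot D.HeckeRel))

/-- The quotient map from `A ⋊ k[B_W]` to the Marin ring. -/
def toMarinRing : D.Semidirect →ₐ[k] D.MarinRing := RingQuot.mkAlgHom k D.HeckeRel

/-- The element `g_s` of the Marin ring. -/
def g (s : B) : D.MarinRing := D.toMarinRing (D.single (ArtinGroup.gen M s) 1)

/-- The image in the Marin ring of an element `c` of `A`. -/
def coeff (c : A) : D.MarinRing := D.toMarinRing (D.single 1 c)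

end MarinDatum

end Marin

/-! ## Juyumaya maps -/

section Juyumaya

variable {B : Type u} {M : CoxeterMatrix B} {W : Type v} [Group W]
variable {C : Type w} {N : CoxeterMatrix C} {U : Type x} [Group U]

/-- A Juyumaya map between Coxeter systems `(W, S)` and `(U, T)`: a group homomorphism
`φ : W → U` and a `W`-equivariant map `e : S → Σ(Φ_U)` (where `W` acts on `S ⊆ W` by conjugation and
on `Σ(Φ_U)` through `φ`) such that `⟨e_s, w . e_t⟩ = ⟨e_s, (s w) . e_t⟩`. -/
@[ext]
structure JuyumayaMap (cs : CoxeterSystem M W) (ct : CoxeterSystem N U) where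
  φ : W →* U
  e : B → RootSubsystem ct
  equivariant : ∀ (g : W) (s t : B), g * cs.simple s * g⁻¹ = cs.simple t → φ g • e s = e t
  mul_eq : ∀ (s t : B) (g : W), e s * (φ g • e t) = e s * (φ (cs.simple s * g) • e t)

namespace JuyumayaMap

variable {cs : CoxeterSystem M W} {ct : CoxeterSystem N U} (J : JuyumayaMap cs ct)

/-- The monoid `Σ(Φ_U)_[e]`: the submonoid of `Σ(Φ_U)` generated by the elements `w . e_s`. -/
def tieMonoid : Submonoid (RootSubsystem ct) :=
  Submonoid.closure {Ψ | ∃ (g : W) (s : B), J.φ g • J.e s = Ψ}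

theorem smul_mem_tieMonoid (g : W) {Ψ : RootSubsystem ct} (h : Ψ ∈ J.tieMonoid) :
    J.φ g • Ψ ∈ J.tieMonoid := by
  induction h using Submonoid.closure_induction with
  | mem Ψ h =>
    obtain ⟨g', s, rfl⟩ := h
    exact Submonoid.subset_closure ⟨g * g', s, by rw [map_mul, mul_smul]⟩
  | one => rw [smul_one]; exact one_mem _
  | mul Ψ Ψ' _ _ h h' => rw [smul_mul']; exact mul_mem h h'

/-- The action `ρ_φ` of `W` on the monoid `Σ(Φ_U)_[e]`. -/
def tieAction : W →* MulAut J.tieMonoid where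
  toFun g :=
    { toFun := fun Ψ => ⟨J.φ g • Ψ.1, J.smul_mem_tieMonoid g Ψ.2⟩
      invFun := fun Ψ => ⟨J.φ g⁻¹ • Ψ.1, J.smul_mem_tieMonoid g⁻¹ Ψ.2⟩
      left_inv := fun Ψ => Subtype.ext (by simp)
      right_inv := fun Ψ => Subtype.ext (by simp)
      map_mul' := fun Ψ Ψ' => Subtype.ext (smul_mul' _ _ _) }
  map_one' := by ext1 Ψ; exact Subtype.ext (by simp)
  map_mul' g g' := by ext1 Ψ; exact Subtype.ext (by simp [mul_smul])

/-- The element `e_s`, seen in `Σ(Φ_U)_[e]`. -/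
def tie (s : B) : J.tieMonoid := ⟨J.e s, Submonoid.subset_closure ⟨1, s, by simp⟩⟩

theorem tieAction_tie (g : W) (s t : B) (h : g * cs.simple s * g⁻¹ = cs.simple t) :
    J.tieAction g (J.tie s) = J.tie t :=
  Subtype.ext (J.equivariant g s t h)

theorem tie_mul_self (s : B) : J.tie s * J.tie s = J.tie s :=
  Subtype.ext (RootSubsystem.mul_self _)

variable {R : Type y} [CommRing R]

/-- The monoid algebra `R[Σ(Φ_U)_[e]]`. -/
abbrev TieAlgebra (J : JuyumayaMap cs ct) (R : Type y) [CommRing R] : Type _ :=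
  MonoidAlgebra R J.tieMonoid

/-- The element `1 + (r - 1) e_s` of `R[Σ(Φ_U)_[e]]`, for `r` in `R`. -/
def hat (s : B) (r : R) : J.TieAlgebra R := 1 + (r - 1) • MonoidAlgebra.of R J.tieMonoid (J.tie s)

theorem hat_mul_hat (s : B) (r r' : R) (h : r * r' = 1) : J.hat s r * J.hat s r' = 1 := by
  have he : MonoidAlgebra.of R J.tieMonoid (J.tie s) * MonoidAlgebra.of R J.tieMonoid (J.tie s) =
      MonoidAlgebra.of R J.tieMonoid (J.tie s) := by
    rw [← map_mul, tie_mul_self]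
  simp only [hat, add_mul, mul_add, one_mul, mul_one, smul_mul_assoc, mul_smul_comm, he]
  have h3 : (r - 1) + ((r' - 1) + (r' - 1) * (r - 1)) = 0 := by linear_combination h
  rw [add_assoc, smul_add, smul_smul, ← add_smul, ← add_smul, h3, zero_smul, add_zero]

/-- The unit `ê_s = 1 + (u_s - 1) e_s` of `R[Σ(Φ_U)_[e]]`. -/
def hatUnit (u : B → Rˣ) (s : B) : (J.TieAlgebra R)ˣ where
  val := J.hat s (u s)
  inv := J.hat s ((u s)⁻¹ : Rˣ)
  val_inv := J.hat_mul_hat s _ _ (by simp)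
  inv_val := J.hat_mul_hat s _ _ (by simp)

/-- The Marin datum `(R[Σ(Φ_U)_[e]], ρ_φ, ê)` attached to a Juyumaya map and a `W`-equivariant map
`u : S → Rˣ`, where `W` acts trivially on `R`. -/
def marinDatum (u : B → Rˣ)
    (hu : ∀ (g : W) (s t : B), g * cs.simple s * g⁻¹ = cs.simple t → u s = u t) :
    MarinDatum R cs (J.TieAlgebra R) where
  ρ := MonoidAlgebra.domCongrAut.comp J.tieAction
  a := J.hatUnit u
  equivariant g s t h := by
    have h1 := J.tieAction_tie g s t h
    simp [hatUnit, hat, hu g s t h, MonoidAlgebra.domCongrAut, MonoidAlgebra.domCongr, h1]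

end JuyumayaMap

end Juyumaya

/-! ## Type `B` -/

section TypeB

/-- The Coxeter matrix of type `B_n`, with the generators numbered so that the bond of order `4`
joins the first two. (Indices in `Fin n` are one less than the usual labels `1, …, n`.) -/
def typeB (n : ℕ) : CoxeterMatrix (Fin n) := (CoxeterMatrix.B n).reindex Fin.revPerm

theorem typeB_apply (n : ℕ) (i j : Fin n) : typeB n i j =
    if i = j then 1
    else if (i.val = 0 ∧ j.val = 1) ∨ (i.val = 1 ∧ j.val = 0) then 4
    else if i.val + 1 = j.val ∨ j.val + 1 = i.val then 3 else 2 := by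
  have h : typeB n i j = CoxeterMatrix.B n (Fin.rev i) (Fin.rev j) := rfl
  have hi := i.isLt
  have hj := j.isLt
  rw [h]
  simp only [CoxeterMatrix.B, Matrix.of_apply, Fin.rev_inj, Fin.val_rev]
  split_ifs <;> first | rfl | (exfalso; omega)

variable {n : ℕ} {W : Type v} [Group W] {U : Type w} [Group U]
variable {cs : CoxeterSystem (typeB n) W} {ct : CoxeterSystem (CoxeterMatrix.A n) U}

/-- `J` is the Juyumaya map `W(B_n) → W(A_n)` that kills `s_1`: one has `φ(s_1) = 1`, `φ(s_i) = t_i`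
for `i ≥ 2`, and `e` takes the values `⟨t_1⟩`, `⟨t_2⟩` at the representatives `s_1`, `s_2` of the
conjugacy classes of generators. -/
structure IsBtoA (J : JuyumayaMap cs ct) : Prop where
  φ_simple : ∀ i : Fin n, J.φ (cs.simple i) = if i.val = 0 then 1 else ct.simple i
  e_representative : ∀ i : Fin n, i.val ≤ 1 → J.e i = rankOne ct i

/-- The ties `f_1 = e_1` and `f_i = s_i . f_{i-1}`. -/
def fTieAux (J : JuyumayaMap cs ct) : (i : ℕ) → i < n → J.tieMonoid
  | 0, h => J.tie ⟨0, h⟩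
  | i + 1, h => J.tieAction (cs.simple ⟨i + 1, h⟩) (fTieAux J i (Nat.lt_of_succ_lt h))

/-- The tie `f_i`. -/
def fTie (J : JuyumayaMap cs ct) (i : Fin n) : J.tieMonoid := fTieAux J i.val i.isLt

/-- The generators of the type `B` braids and ties algebra. -/
inductive Gen (n : ℕ) : Type
  | g (i : Fin n) : Gen n
  | e (i : Fin n) : Gen n
  | f (i : Fin n) : Gen n

/-- The distance `|i - j|`. -/
def gap (i j : Fin n) : ℕ := ((i.val : ℤ) - (j.val : ℤ)).natAbs

/-- `{i, j} = {1, 2}` in the usual labelling. -/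
def IsFirstPair (i j : Fin n) : Prop := (i.val = 0 ∧ j.val = 1) ∨ (i.val = 1 ∧ j.val = 0)

variable {R : Type y} [CommRing R]

/-- The generator `g_i` of the free algebra. -/
def gX (i : Fin n) : FreeAlgebra R (Gen n) := FreeAlgebra.ι R (Gen.g i)

/-- The generator `e_i` of the free algebra. -/
def eX (i : Fin n) : FreeAlgebra R (Gen n) := FreeAlgebra.ι R (Gen.e i)

/-- The generator `f_i` of the free algebra. -/
def fX (i : Fin n) : FreeAlgebra R (Gen n) := FreeAlgebra.ι R (Gen.f i)

/-- The defining relations of the type `B` braids and ties algebra with parameters `u_i`. -/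
inductive FloresRel (u : Fin n → Rˣ) : FreeAlgebra R (Gen n) → FreeAlgebra R (Gen n) → Prop
  | gg (i j : Fin n) : 1 < gap i j → FloresRel u (gX i * gX j) (gX j * gX i)
  | gggg (i j : Fin n) : i.val = 0 → j.val = 1 →
      FloresRel u (gX i * gX j * gX i * gX j) (gX j * gX i * gX j * gX i)
  | ggg (i j : Fin n) : gap i j = 1 → ¬ IsFirstPair i j →
      FloresRel u (gX i * gX j * gX i) (gX j * gX i * gX j)
  | quadratic (i : Fin n) :
      FloresRel u (gX i * gX i) (1 + ((u i : R) - 1) • (eX i * (1 - gX i)))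
  | ge (i j : Fin n) : gap i j ≠ 1 ∨ (i.val = 0 ∧ j.val = 1) →
      FloresRel u (gX i * eX j) (eX j * gX i)
  | gge (i j : Fin n) : gap i j = 1 → ¬ IsFirstPair i j →
      FloresRel u (gX j * gX i * eX j) (eX i * gX j * gX i)
  | ee (i j : Fin n) : FloresRel u (eX i * eX j) (eX j * eX i)
  | e_sq (i : Fin n) : FloresRel u (eX i * eX i) (eX i)
  | eeg_ege (i j : Fin n) : gap i j = 1 → ¬ IsFirstPair i j →
      FloresRel u (eX j * eX i * gX j) (eX i * gX j * eX i)
  | ege_gee (i j : Fin n) : gap i j = 1 → ¬ IsFirstPair i j →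
      FloresRel u (eX i * gX j * eX i) (gX j * eX i * eX j)
  | eeg_ege_first (i j : Fin n) : i.val = 0 → j.val = 1 →
      FloresRel u (eX i * eX j * gX j) (eX j * gX j * eX i)
  | ege_gee_first (i j : Fin n) : i.val = 0 → j.val = 1 →
      FloresRel u (eX j * gX j * eX i) (gX j * eX i * eX j)
  | f_first (i : Fin n) : i.val = 0 → FloresRel u (fX i) (eX i)
  | gf (i j : Fin n) : i.val = 0 ∨ (1 ≤ i.val ∧ j.val + 1 ≠ i.val ∧ j ≠ i) →
      FloresRel u (gX i * fX j) (fX j * gX i)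
  | ef (i j : Fin n) : FloresRel u (eX i * fX j) (fX j * eX i)
  | ff (i j : Fin n) : FloresRel u (fX i * fX j) (fX j * fX i)
  | gf_pred (i j : Fin n) : j.val + 1 = i.val → FloresRel u (gX i * fX j) (fX i * gX i)
  | gf_self (i j : Fin n) : j.val + 1 = i.val → FloresRel u (gX i * fX i) (fX j * gX i)
  | ef_succ (i j : Fin n) : j.val = i.val + 1 → FloresRel u (eX j * fX i) (eX j * fX j)
  | ef_ff (i j : Fin n) : j.val = i.val + 1 → FloresRel u (eX j * fX i) (fX j * fX i)

/-- Flores' type `B` braids and ties algebra `𝓔ᴮ_n` over `R`, with parameters `u_i`. -/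
def FloresAlgebra (u : Fin n → Rˣ) : Type y := RingQuot (FloresRel u)

instance (u : Fin n → Rˣ) : Ring (FloresAlgebra u) := inferInstanceAs (Ring (RingQuot _))

instance (u : Fin n → Rˣ) : Algebra R (FloresAlgebra u) :=
  inferInstanceAs (Algebra R (RingQuot _))

namespace FloresAlgebra

/-- The quotient map from the free algebra to `𝓔ᴮ_n`. -/
def mk (u : Fin n → Rˣ) : FreeAlgebra R (Gen n) →ₐ[R] FloresAlgebra u :=
  RingQuot.mkAlgHom R (FloresRel u)

/-- The generator `g_i` of `𝓔ᴮ_n`. -/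
def g (u : Fin n → Rˣ) (i : Fin n) : FloresAlgebra u := mk u (gX i)

/-- The generator `e_i` of `𝓔ᴮ_n`. -/
def e (u : Fin n → Rˣ) (i : Fin n) : FloresAlgebra u := mk u (eX i)

/-- The generator `f_i` of `𝓔ᴮ_n`. -/
def f (u : Fin n → Rˣ) (i : Fin n) : FloresAlgebra u := mk u (fX i)

end FloresAlgebra

namespace JuyumayaMap

/-- The image in the Marin ring of an element of the monoid `Σ(Φ_U)_[e]`. -/
def tieImage {B : Type u} {M : CoxeterMatrix B} {W : Type v} [Group W]
    {C : Type w} {N : CoxeterMatrix C} {U : Type x} [Group U]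
    {cs : CoxeterSystem M W} {ct : CoxeterSystem N U} (J : JuyumayaMap cs ct) (u : B → Rˣ)
    (hu : ∀ (g : W) (s t : B), g * cs.simple s * g⁻¹ = cs.simple t → u s = u t)
    (Ψ : J.tieMonoid) : (J.marinDatum u hu).MarinRing :=
  (J.marinDatum u hu).coeff (MonoidAlgebra.of R J.tieMonoid Ψ)

end JuyumayaMap

end TypeB

end BraidsTies

end

noncomputable section

namespace BraidsTies

universe u v w x y

/-! ## Root subsystems in type `A` -/

section TypeA

variable {n : ℕ} {U : Type w} [Group U] (ct : CoxeterSystem (CoxeterMatrix.A n) U)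

/-! In type `A_n` everything is read off the points 0, …, n. Roots are ordered pairs of distinct
points, t_i is the transposition of i-1 and i (`reflect_rootVec`, `geomRep_rootVec`), a root
subsystem is an equivalence relation on the points, and the product is the join. The subsystem
`pairSub` of a single pair {a,b} is the basic tie. Any commuting idempotents D(a,b), symmetric,
trivial on the diagonal and with D(a,b)D(b,c) = D(a,b)D(a,c), extend to a homomorphism from the
monoid of subsystems (`relProdHom`).

For (a), uniqueness holds because s_i and s_{i+1} are conjugate for i ≥ 2, so that e_{s_2}
determines the later values (`e_eq_rankOne`). For existence, the delicate point is equivariance at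
s_1, which φ kills: an element of W centralizing s_1 must be shown to fix the pair {0,1}. This is
seen on signed points, where s_1 is the sign change at the point 1 (`bSignedHom_mul_signFlip`).

For (b), conjugation by g_s acts on ties as s does, and the quadratic relation writes the inverse of
g_s in terms of g_s and e_s. Hence every tie w.e_s lies in the subalgebra generated by the g_i and
e_i.

For (c), e_i is the tie {i-1,i} and f_i is the tie {0,i}. Flores' relations hold in the Marin ring
because, once all g's stand on the right, they are braid relations, the quadratic relation or
identities between joins (`respects_floresRel`). In the other direction a tie is needed in Flores'
algebra for every pair of points. For 1 ≤ p < q ≤ n it is the conjugate of e_{p+1} by g_q ⋯ g_{p+2}.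
Although g_i² is not 1, the braid and tie relations force conjugation by g_2, …, g_n to permute
these ties and the f_i through the symmetric group on 1, …, n (`IsBraidTie.smul_pointTie`), while
g_1 commutes with all of them. So every identity among ties can be moved to a standard position,
where it is a defining relation or an easy consequence of the relations
(`IsPointedBraidTie.exists_smul`). The extension property above and that of the Marin ring
(`MarinDatum.lift`) then give the inverse map. -/

theorem typeA_apply (n : ℕ) (i j : Fin n) : CoxeterMatrix.A n i j =
    if i = j then 1 else if j.val + 1 = i.val ∨ i.val + 1 = j.val then 3 else 2 := rfl

/-- The partial sums `α_1 + ⋯ + α_a` of the simple roots. -/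
def coord (a : Fin (n + 1)) : Fin n →₀ ℝ := Fin.partialSum simpleRoot a

theorem coord_zero : coord (0 : Fin (n + 1)) = 0 := Fin.partialSum_zero _

theorem coord_succ (i : Fin n) : coord i.succ = coord i.castSucc + simpleRoot i :=
  Fin.partialSum_succ _ i

/-- The vector joining the points `a` and `b` of `{0, …, n}`; the roots of type `A_n` are those with
`a ≠ b`. -/
def rootVec (a b : Fin (n + 1)) : Fin n →₀ ℝ := coord b - coord a

theorem rootVec_castSucc_succ (i : Fin n) : rootVec i.castSucc i.succ = simpleRoot i := by
  simp [rootVec, coord_succ]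

/-- The map from the root lattice of type `A_n` to the permutation representation. -/
def toPoints (n : ℕ) : (Fin n →₀ ℝ) →ₗ[ℝ] (Fin (n + 1) → ℝ) :=
  Finsupp.linearCombination ℝ fun i : Fin n => Pi.single i.succ 1 - Pi.single i.castSucc 1

theorem toPoints_simpleRoot (i : Fin n) :
    toPoints n (simpleRoot i) = Pi.single i.succ 1 - Pi.single i.castSucc 1 := by
  simp [toPoints, simpleRoot]

theorem toPoints_coord (a : Fin (n + 1)) :
    toPoints n (coord a) = Pi.single a 1 - Pi.single 0 1 := by
  induction a using Fin.induction with
  | zero => simp [coord_zero]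
  | succ i ih => rw [coord_succ, map_add, ih, toPoints_simpleRoot]; abel

/-- The values -2cos(π/m) for m = 1, 3, 2 are 2, -1, 0, the inner products of the vectors e_{i+1} -
e_i. So twice the Tits form is the standard inner product, and pairing with a simple root is a
difference of two coordinates. -/
theorem titsForm_simpleRoot_eq_toPoints (i : Fin n) (v : Fin n →₀ ℝ) :
    2 * titsForm (CoxeterMatrix.A n) (simpleRoot i) v =
      toPoints n v i.succ - toPoints n v i.castSucc := by
  have h : (2 : ℝ) • titsForm (CoxeterMatrix.A n) (simpleRoot i) =
      ((LinearMap.proj i.succ : (Fin (n + 1) → ℝ) →ₗ[ℝ] ℝ) - LinearMap.proj i.castSucc) ∘ₗ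
        toPoints n := by
    ext j
    have h1 := titsForm_simpleRoot (CoxeterMatrix.A n) i j
    have h2 := toPoints_simpleRoot j
    rw [simpleRoot, simpleRoot] at h1
    rw [simpleRoot] at h2
    simp only [LinearMap.coe_comp, Function.comp_apply, Finsupp.lsingle_apply,
      LinearMap.smul_apply, simpleRoot, h1, LinearMap.sub_apply, LinearMap.proj_apply, h2,
      Pi.sub_apply, Pi.single_apply, typeA_apply, smul_eq_mul, Fin.ext_iff, Fin.val_succ,
      Fin.val_castSucc]
    split_ifs <;> first | (exfalso; omega) | norm_num
  exact congrArg (fun f => f v) h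

theorem titsForm_rootVec (a b : Fin (n + 1)) (v : Fin n →₀ ℝ) :
    2 * titsForm (CoxeterMatrix.A n) (rootVec a b) v = toPoints n v b - toPoints n v a := by
  have key : ∀ c : Fin (n + 1),
      2 * titsForm (CoxeterMatrix.A n) (coord c) v = toPoints n v c - toPoints n v 0 := by
    intro c
    induction c using Fin.induction with
    | zero => simp [coord_zero]
    | succ i ih =>
      rw [coord_succ, map_add, LinearMap.add_apply, mul_add, ih, titsForm_simpleRoot_eq_toPoints]
      ring
  rw [rootVec, map_sub, LinearMap.sub_apply, mul_sub, key, key]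
  ring

theorem reflect_rootVec {a b : Fin (n + 1)} (hab : a ≠ b) (c d : Fin (n + 1)) :
    reflect (CoxeterMatrix.A n) (rootVec a b) (rootVec c d) =
      rootVec (Equiv.swap a b c) (Equiv.swap a b d) := by
  have key : ∀ c : Fin (n + 1), coord (Equiv.swap a b c) =
      coord c - ((Pi.single c 1 : Fin (n + 1) → ℝ) b - (Pi.single c 1 : Fin (n + 1) → ℝ) a) •
        (coord b - coord a) := by
    intro c
    rcases eq_or_ne c a with rfl | hca
    · simp [hab.symm]
    rcases eq_or_ne c b with rfl | hcb
    · simp [hab]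
    · simp [Equiv.swap_apply_of_ne_of_ne hca hcb, hca.symm, hcb.symm]
  rw [reflect, titsForm_rootVec, rootVec, rootVec, rootVec, key c, key d, map_sub, toPoints_coord,
    toPoints_coord]
  simp only [Pi.sub_apply]
  module

theorem rootVec_injective {a b c d : Fin (n + 1)} (hab : a ≠ b) (h : rootVec a b = rootVec c d) :
    a = c ∧ b = d := by
  have h1 : ∀ x, (Pi.single b 1 - Pi.single a 1 : Fin (n + 1) → ℝ) x =
      (Pi.single d 1 - Pi.single c 1 : Fin (n + 1) → ℝ) x := fun x => by
    have := congrFun (congrArg (toPoints n) h) x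
    simpa only [rootVec, map_sub, toPoints_coord, sub_sub_sub_cancel_right] using this
  have ha := h1 a
  have hb := h1 b
  simp only [Pi.sub_apply, Pi.single_apply, if_neg hab, if_neg hab.symm, if_true] at ha hb
  constructor
  · by_contra hac
    rw [if_neg hac] at ha
    split_ifs at ha <;> norm_num at ha
  · by_contra hbd
    rw [if_neg hbd] at hb
    split_ifs at hb <;> norm_num at hb

/-- The adjacent transposition of `{0, …, n}` attached to a generator of type `A_n`. -/
def adjSwap (i : Fin n) : Equiv.Perm (Fin (n + 1)) := Equiv.swap i.castSucc i.succ

theorem adjSwap_mul_self (i : Fin n) : adjSwap i * adjSwap i = 1 := Equiv.swap_mul_self _ _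

theorem adjSwap_commute (i j : Fin n) (h1 : i.val + 1 ≠ j.val) (h2 : j.val + 1 ≠ i.val) :
    adjSwap i * adjSwap j = adjSwap j * adjSwap i := by
  rcases eq_or_ne i j with rfl | h
  · rfl
  apply Equiv.Perm.Disjoint.commute
  have h3 : i.val ≠ j.val := fun h' => h (Fin.ext h')
  intro x
  by_cases hx : x = i.castSucc ∨ x = i.succ
  · right
    apply Equiv.swap_apply_of_ne_of_ne <;> rcases hx with rfl | rfl <;> simp [Fin.ext_iff] <;> omega
  · left
    rw [not_or] at hx
    exact Equiv.swap_apply_of_ne_of_ne hx.1 hx.2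

theorem adjSwap_braid (i j : Fin n) (h : j.val = i.val + 1) :
    adjSwap i * adjSwap j * adjSwap i = adjSwap j * adjSwap i * adjSwap j := by
  have e : j.castSucc = i.succ := by ext; simp [h]
  rw [adjSwap, adjSwap, e, Equiv.swap_mul_swap_mul_swap, Equiv.swap_comm i.succ j.succ,
    Equiv.swap_comm i.castSucc i.succ, Equiv.swap_mul_swap_mul_swap, Equiv.swap_comm]
  all_goals simp [Fin.ext_iff]; try omega

theorem mul_pow_three_of_braid {G : Type*} [Group G] {a b : G} (ha : a * a = 1) (hb : b * b = 1)
    (h : a * b * a = b * a * b) : (a * b) ^ 3 = 1 := by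
  calc (a * b) ^ 3 = (a * b * a) * (b * a * b) := by simp only [pow_succ, pow_zero]; group
    _ = a * b * (a * a) * b * a := by rw [← h]; group
    _ = 1 := by rw [ha, mul_one, mul_assoc a, hb, mul_one, ha]

theorem mul_pow_two_of_commute {G : Type*} [Group G] {a b : G} (ha : a * a = 1) (hb : b * b = 1)
    (h : a * b = b * a) : (a * b) ^ 2 = 1 := by
  calc (a * b) ^ 2 = (a * b) * (b * a) := by rw [pow_two, ← h]
    _ = 1 := by rw [mul_assoc, ← mul_assoc b, hb, one_mul, ha]

theorem adjSwap_isLiftable : (CoxeterMatrix.A n).IsLiftable adjSwap := by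
  intro i j
  rw [typeA_apply]
  split_ifs with h h'
  · rw [h, adjSwap_mul_self, pow_one]
  · refine mul_pow_three_of_braid (adjSwap_mul_self i) (adjSwap_mul_self j) ?_
    rcases h' with h' | h'
    · exact (adjSwap_braid j i h'.symm).symm
    · exact adjSwap_braid i j h'.symm
  · rw [not_or] at h'
    exact mul_pow_two_of_commute (adjSwap_mul_self i) (adjSwap_mul_self j)
      (adjSwap_commute i j h'.2 h'.1)

/-- The permutation of `{0, …, n}` attached to an element of a Coxeter group of type `A_n`. -/
def permHom : U →* Equiv.Perm (Fin (n + 1)) := ct.lift ⟨adjSwap, adjSwap_isLiftable⟩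

theorem permHom_simple (i : Fin n) : permHom ct (ct.simple i) = adjSwap i :=
  ct.lift_apply_simple adjSwap_isLiftable i

theorem geomRep_rootVec (g : U) (a b : Fin (n + 1)) :
    geomRep ct g (rootVec a b) = rootVec (permHom ct g a) (permHom ct g b) := by
  induction g using ct.simple_induction_left generalizing a b with
  | one => simp
  | mul_simple_left g i ih =>
    rw [map_mul, LinearEquiv.mul_apply, ih, geomRep_simple, simpleReflection_apply,
      ← rootVec_castSucc_succ, reflect_rootVec (Fin.castSucc_lt_succ (i := i)).ne, map_mul,
      permHom_simple]
    rfl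

theorem mem_roots_iff (α : Fin n →₀ ℝ) :
    α ∈ roots ct ↔ ∃ a b : Fin (n + 1), a ≠ b ∧ rootVec a b = α := by
  constructor
  · rintro ⟨g, i, rfl⟩
    exact ⟨_, _, (permHom ct g).injective.ne (Fin.castSucc_lt_succ (i := i)).ne,
      by rw [← rootVec_castSucc_succ, geomRep_rootVec]⟩
  · rintro ⟨a, b, hab, rfl⟩
    -- A positive root is lengthened one point at a time by reflecting in the next simple root. A
    -- negative root is the reflection of a positive root in itself.
    have key : ∀ a b : Fin (n + 1), a < b → rootVec a b ∈ roots ct := by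
      intro a b
      induction b using Fin.induction with
      | zero => intro h; exact absurd h (Fin.not_lt_zero a)
      | succ i ih =>
        intro h
        have hs : rootVec i.castSucc i.succ ∈ roots ct := by
          rw [rootVec_castSucc_succ]; exact simpleRoot_mem_roots ct i
        rcases eq_or_ne a i.castSucc with rfl | hne
        · exact hs
        · have h1 := reflect_mem_roots ct hs (ih (lt_of_le_of_ne (Fin.le_castSucc_iff.2 h) hne))
          rwa [reflect_rootVec (by simp [Fin.ext_iff]), Equiv.swap_apply_left,
            Equiv.swap_apply_of_ne_of_ne hne h.ne] at h1
    rcases lt_or_gt_of_ne hab with h | h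
    · exact key a b h
    · have h1 := key b a h
      have h2 := reflect_mem_roots ct h1 h1
      rwa [reflect_rootVec h.ne, Equiv.swap_apply_left, Equiv.swap_apply_right] at h2

variable {ct}

/-! ### Root subsystems of type `A_n` as equivalence relations on points. -/

namespace RootSubsystem

/-- Two points are related by a root subsystem of type `A_n` if they are equal or joined by one of
its roots. -/
def Rel (Θ : RootSubsystem ct) (a b : Fin (n + 1)) : Prop := a = b ∨ rootVec a b ∈ Θ.carrier

theorem rel_refl (Θ : RootSubsystem ct) (a : Fin (n + 1)) : Θ.Rel a a := Or.inl rfl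

theorem Rel.symm {Θ : RootSubsystem ct} {a b : Fin (n + 1)} (h : Θ.Rel a b) : Θ.Rel b a := by
  rcases eq_or_ne a b with rfl | hab
  · exact h
  have h1 := h.resolve_left hab
  have h2 := Θ.reflect_mem _ h1 _ h1
  rw [reflect_rootVec hab, Equiv.swap_apply_left, Equiv.swap_apply_right] at h2
  exact Or.inr h2

/-- For three distinct points, reflecting the root joining b and c in the root joining a and b
yields the root joining a and c. -/
theorem Rel.trans {Θ : RootSubsystem ct} {a b c : Fin (n + 1)} (h : Θ.Rel a b) (h' : Θ.Rel b c) :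
    Θ.Rel a c := by
  rcases eq_or_ne a b with rfl | hab
  · exact h'
  rcases eq_or_ne b c with rfl | hbc
  · exact h
  rcases eq_or_ne a c with rfl | hac
  · exact Or.inl rfl
  have h2 := Θ.reflect_mem _ (h.resolve_left hab) _ (h'.resolve_left hbc)
  rw [reflect_rootVec hab, Equiv.swap_apply_right,
    Equiv.swap_apply_of_ne_of_ne hac.symm hbc.symm] at h2
  exact Or.inr h2

theorem rel_comm {Θ : RootSubsystem ct} {a b : Fin (n + 1)} : Θ.Rel a b ↔ Θ.Rel b a :=
  ⟨Rel.symm, Rel.symm⟩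

theorem rel_iff_mem {Θ : RootSubsystem ct} {a b : Fin (n + 1)} (hab : a ≠ b) :
    Θ.Rel a b ↔ rootVec a b ∈ Θ.carrier := or_iff_right hab

theorem rel_one_iff {a b : Fin (n + 1)} : (1 : RootSubsystem ct).Rel a b ↔ a = b :=
  or_iff_left (Set.notMem_empty _)

theorem carrier_subset_iff_rel (Ψ Θ : RootSubsystem ct) :
    Ψ.carrier ⊆ Θ.carrier ↔ ∀ a b, Ψ.Rel a b → Θ.Rel a b := by
  constructor
  · rintro h a b (rfl | h1)
    · exact rel_refl Θ a
    · exact Or.inr (h h1)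
  · intro h α hα
    obtain ⟨a, b, hab, rfl⟩ := (mem_roots_iff ct α).1 (Ψ.subset_roots hα)
    exact (h a b (Or.inr hα)).resolve_left hab

/-- The root subsystem of type `A_n` attached to an equivalence relation on `{0, …, n}`. -/
def ofSetoid (ct : CoxeterSystem (CoxeterMatrix.A n) U) (r : Setoid (Fin (n + 1))) :
    RootSubsystem ct where
  carrier := {α | ∃ a b, a ≠ b ∧ r a b ∧ rootVec a b = α}
  subset_roots := by
    rintro _ ⟨a, b, hab, -, rfl⟩
    exact (mem_roots_iff ct _).2 ⟨a, b, hab, rfl⟩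
  reflect_mem := by
    rintro _ ⟨a, b, hab, h, rfl⟩ _ ⟨c, d, hcd, h', rfl⟩
    have key : ∀ x, r (Equiv.swap a b x) x := by
      intro x
      rcases eq_or_ne x a with rfl | hxa
      · rw [Equiv.swap_apply_left]; exact r.symm h
      rcases eq_or_ne x b with rfl | hxb
      · rw [Equiv.swap_apply_right]; exact h
      · rw [Equiv.swap_apply_of_ne_of_ne hxa hxb]
    exact ⟨_, _, (Equiv.swap a b).injective.ne hcd,
      r.trans (key c) (r.trans h' (r.symm (key d))), (reflect_rootVec hab c d).symm⟩

theorem rel_ofSetoid (r : Setoid (Fin (n + 1))) {a b : Fin (n + 1)} :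
    (ofSetoid ct r).Rel a b ↔ r a b := by
  constructor
  · rintro (rfl | ⟨c, d, hcd, h, h'⟩)
    · exact r.refl a
    · obtain ⟨rfl, rfl⟩ := rootVec_injective hcd h'
      exact h
  · intro h
    rcases eq_or_ne a b with rfl | hab
    · exact rel_refl _ a
    · exact Or.inr ⟨a, b, hab, h, rfl⟩

end RootSubsystem

/-! ### Ties of pairs of points and their triangle identities. -/

open RootSubsystem

/-- The root subsystem generated by the root that joins two points (trivial if they are equal). -/
def pairSub (ct : CoxeterSystem (CoxeterMatrix.A n) U) (a b : Fin (n + 1)) : RootSubsystem ct :=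
  RootSubsystem.generated ct {α | a ≠ b ∧ rootVec a b = α}

theorem pairSub_subset_iff (a b : Fin (n + 1)) (Θ : RootSubsystem ct) :
    (pairSub ct a b).carrier ⊆ Θ.carrier ↔ Θ.Rel a b := by
  rw [pairSub, generated_subset_iff]
  · rcases eq_or_ne a b with rfl | hab
    · simpa using rel_refl Θ a
    · simp [rel_iff_mem, hab]
  · rintro _ ⟨hab, rfl⟩
    exact (mem_roots_iff ct _).2 ⟨a, b, hab, rfl⟩

theorem rankOne_eq_pairSub (i : Fin n) : rankOne ct i = pairSub ct i.castSucc i.succ := by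
  refine eq_of_forall_subset_iff fun Θ => ?_
  rw [pairSub_subset_iff, rankOne, generated_subset_iff, rel_iff_mem (by simp [Fin.ext_iff]),
    Set.singleton_subset_iff, rootVec_castSucc_succ]
  exact Set.singleton_subset_iff.2 (simpleRoot_mem_roots ct i)

theorem RootSubsystem.rel_smul_iff (g : U) (Θ : RootSubsystem ct) (a b : Fin (n + 1)) :
    (g • Θ).Rel (permHom ct g a) (permHom ct g b) ↔ Θ.Rel a b := by
  simp only [Rel, smul_carrier, ← geomRep_rootVec, (permHom ct g).injective.eq_iff,
    (geomRep ct g).injective.mem_set_image]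

theorem smul_pairSub (g : U) (a b : Fin (n + 1)) :
    g • pairSub ct a b = pairSub ct (permHom ct g a) (permHom ct g b) := by
  refine eq_of_forall_subset_iff fun Θ => ?_
  rw [smul_subset_iff, pairSub_subset_iff, pairSub_subset_iff, ← rel_smul_iff g, smul_inv_smul]

theorem pairSub_comm (a b : Fin (n + 1)) : pairSub ct a b = pairSub ct b a :=
  eq_of_forall_subset_iff fun Θ => by rw [pairSub_subset_iff, pairSub_subset_iff, rel_comm]

theorem pairSub_mul_pairSub (a b c : Fin (n + 1)) :
    pairSub ct a b * pairSub ct b c = pairSub ct a b * pairSub ct a c := by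
  refine eq_of_forall_subset_iff fun Θ => ?_
  simp only [mul_subset_iff, pairSub_subset_iff]
  exact and_congr_right fun h => ⟨h.trans, h.symm.trans⟩

/-- Once a and b are related, their transposition moves every point within its class. This is what
yields the second axiom of a Juyumaya map. -/
theorem pairSub_mul_pairSub_swap (a b c d : Fin (n + 1)) :
    pairSub ct a b * pairSub ct (Equiv.swap a b c) (Equiv.swap a b d) =
      pairSub ct a b * pairSub ct c d := by
  refine eq_of_forall_subset_iff fun Θ => ?_
  simp only [mul_subset_iff, pairSub_subset_iff]
  refine and_congr_right fun h => ?_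
  have key : ∀ x, Θ.Rel (Equiv.swap a b x) x := by
    intro x
    rcases eq_or_ne x a with rfl | hxa
    · rw [Equiv.swap_apply_left]; exact h.symm
    rcases eq_or_ne x b with rfl | hxb
    · rw [Equiv.swap_apply_right]; exact h
    · rw [Equiv.swap_apply_of_ne_of_ne hxa hxb]; exact rel_refl Θ x
  exact ⟨fun h' => (key c).symm.trans (h'.trans (key d)),
    fun h' => (key c).trans (h'.trans (key d).symm)⟩

/-! ### Homomorphisms out of the monoid of root subsystems of type `A_n` -/

section Lift

variable {M : Type*} [CommMonoid M]

theorem mul_prod_eq_self {ι : Type*} (s : Finset ι) (D : ι → M) (x : M)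
    (h : ∀ i ∈ s, x * D i = x) : x * ∏ i ∈ s, D i = x := by
  classical
  induction s using Finset.induction_on with
  | empty => simp
  | insert i s hi ih =>
    rw [Finset.prod_insert hi, ← mul_assoc, h i (Finset.mem_insert_self i s),
      ih fun j hj => h j (Finset.mem_insert_of_mem hj)]

theorem prod_mul_eq_self {ι : Type*} {s : Finset ι} {D : ι → M} {i : ι} (hi : i ∈ s)
    (h : D i * D i = D i) : (∏ j ∈ s, D j) * D i = ∏ j ∈ s, D j := by
  classical
  rw [← Finset.prod_erase_mul s D hi, mul_assoc, h]

variable (D : Fin (n + 1) → Fin (n + 1) → M)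

open Classical in
/-- The product of the values of `D` over all pairs of points that are related by a root
subsystem. -/
def relProd (Θ : RootSubsystem ct) : M :=
  ∏ p : Fin (n + 1) × Fin (n + 1) with Θ.Rel p.1 p.2, D p.1 p.2

variable {D}

theorem relProd_mul_self (hidem : ∀ a b, D a b * D a b = D a b) {Θ : RootSubsystem ct}
    {a b : Fin (n + 1)} (h : Θ.Rel a b) : relProd D Θ * D a b = relProd D Θ := by
  classical
  exact prod_mul_eq_self (D := fun p : Fin (n + 1) × Fin (n + 1) => D p.1 p.2) (i := (a, b))
    (by simpa using h) (hidem a b)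

/-- The equivalence relation formed by the pairs `a, b` for which `D a b` is absorbed by `x`. -/
def absorbSetoid (hD : ∀ a, D a a = 1) (hsymm : ∀ a b, D a b = D b a)
    (htrans : ∀ a b c, D a b * D b c = D a b * D a c) (x : M) : Setoid (Fin (n + 1)) where
  r a b := x * D a b = x
  iseqv :=
    { refl := fun a => by rw [hD, mul_one]
      symm := fun {a b} hab => by rwa [hsymm]
      trans := fun {a b c} hab hbc => by
        rw [← hab, mul_assoc, ← htrans, ← mul_assoc, hab, hbc] }

/-- The pairs absorbed by x form an equivalence relation, hence a root subsystem. It contains Ψ,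
therefore Θ, so x absorbs each factor of `relProd D Θ`. This replaces any explicit description of
generated subsystems. -/
theorem mul_relProd_of_subset (hD : ∀ a, D a a = 1) (hsymm : ∀ a b, D a b = D b a)
    (htrans : ∀ a b c, D a b * D b c = D a b * D a c) {x : M} (Θ : RootSubsystem ct)
    (Ψ : RootSubsystem ct) (hx : ∀ a b, Ψ.Rel a b → x * D a b = x)
    (h : ∀ Ξ : RootSubsystem ct, Ψ.carrier ⊆ Ξ.carrier → Θ.carrier ⊆ Ξ.carrier) :
    x * relProd D Θ = x := by
  let r := absorbSetoid hD hsymm htrans x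
  refine mul_prod_eq_self _ _ _ fun p hp => ?_
  have h1 := (carrier_subset_iff_rel _ _).1 (h (ofSetoid ct r)
    ((carrier_subset_iff_rel _ _).2 fun a b hab => (rel_ofSetoid r).2 (hx a b hab)))
  exact (rel_ofSetoid r).1 (h1 p.1 p.2 (by simpa using hp))

/-- Commuting idempotents `D a b` attached to the pairs of points of `{0, …, n}`, trivial on the
diagonal and subject to `D a b * D b c = D a b * D a c`, define a homomorphism from the monoid of
root subsystems of type `A_n`. -/
def relProdHom (ct : CoxeterSystem (CoxeterMatrix.A n) U) (hD : ∀ a, D a a = 1)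
    (hsymm : ∀ a b, D a b = D b a) (hidem : ∀ a b, D a b * D a b = D a b)
    (htrans : ∀ a b c, D a b * D b c = D a b * D a c) : RootSubsystem ct →* M where
  toFun := relProd D
  map_one' := by
    have := mul_relProd_of_subset (ct := ct) hD hsymm htrans (x := 1) 1 1
      (fun a b h => by rw [rel_one_iff.1 h, hD, mul_one]) fun Ξ h => h
    rwa [one_mul] at this
  map_mul' Ψ Ψ' := by
    have hΨ : ∀ {Θ : RootSubsystem ct} {a b}, Θ.Rel a b → relProd D Θ * D a b = relProd D Θ :=
      fun h => relProd_mul_self hidem h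
    have hsub := (mul_subset_iff Ψ Ψ' (Ψ * Ψ')).1 subset_rfl
    -- The two sides of the multiplicativity claim are shown to absorb each other; in a commutative
    -- monoid this makes them equal.
    have h1 : relProd D (Ψ * Ψ') * relProd D Ψ = relProd D (Ψ * Ψ') :=
      mul_relProd_of_subset hD hsymm htrans Ψ (Ψ * Ψ') (fun a b h => hΨ h)
        fun Ξ h => hsub.1.trans h
    have h2 : relProd D (Ψ * Ψ') * relProd D Ψ' = relProd D (Ψ * Ψ') :=
      mul_relProd_of_subset hD hsymm htrans Ψ' (Ψ * Ψ') (fun a b h => hΨ h)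
        fun Ξ h => hsub.2.trans h
    -- The pairs absorbed by the product of the two values form a subsystem containing Ψ and Ψ',
    -- hence containing the subsystem they generate.
    have h3 : relProd D Ψ * relProd D Ψ' * relProd D (Ψ * Ψ') = relProd D Ψ * relProd D Ψ' := by
      let r := absorbSetoid hD hsymm htrans (relProd D Ψ * relProd D Ψ')
      refine mul_relProd_of_subset hD hsymm htrans _ (ofSetoid ct r)
        (fun a b h => (rel_ofSetoid r).1 h) fun Ξ h => ?_
      refine (mul_subset_iff _ _ _).2 ⟨?_, ?_⟩ <;> refine subset_trans ?_ h <;>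
        refine (carrier_subset_iff_rel _ _).2 fun a b hab => (rel_ofSetoid r).2 ?_
      · change _ * _ * _ = _
        rw [mul_right_comm, hΨ hab]
      · change _ * _ * _ = _
        rw [mul_assoc, hΨ hab]
    rw [← h3, mul_comm (_ * _), ← mul_assoc, h1, h2]

theorem relProdHom_pairSub (hD : ∀ a, D a a = 1) (hsymm : ∀ a b, D a b = D b a)
    (hidem : ∀ a b, D a b * D a b = D a b) (htrans : ∀ a b c, D a b * D b c = D a b * D a c)
    (a b : Fin (n + 1)) : relProdHom ct hD hsymm hidem htrans (pairSub ct a b) = D a b := by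
  have h1 : relProd D (pairSub ct a b) * D a b = relProd D (pairSub ct a b) :=
    relProd_mul_self hidem ((pairSub_subset_iff a b _).1 subset_rfl)
  have h2 : D a b * relProd D (pairSub ct a b) = D a b := by
    let r := absorbSetoid hD hsymm htrans (D a b)
    refine mul_relProd_of_subset hD hsymm htrans _ (ofSetoid ct r)
      (fun a b h => (rel_ofSetoid r).1 h) fun Ξ h => ?_
    exact subset_trans ((pairSub_subset_iff a b _).2 ((rel_ofSetoid r).2 (hidem a b))) h
  change relProd D (pairSub ct a b) = _
  rw [← h1, mul_comm, h2]

end Lift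

end TypeA

/-! ## The Juyumaya map from type `B` to type `A` -/

section BtoA

variable {n : ℕ} {W : Type v} [Group W] {U : Type w} [Group U]
variable {cs : CoxeterSystem (typeB n) W} {ct : CoxeterSystem (CoxeterMatrix.A n) U}

theorem adjSwap_castSucc (i : Fin n) : adjSwap i i.castSucc = i.succ := Equiv.swap_apply_left _ _

theorem adjSwap_succ (i : Fin n) : adjSwap i i.succ = i.castSucc := Equiv.swap_apply_right _ _

theorem adjSwap_of_ne (i : Fin n) {a : Fin (n + 1)} (h1 : a.val ≠ i.val)
    (h2 : a.val ≠ i.val + 1) : adjSwap i a = a :=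
  Equiv.swap_apply_of_ne_of_ne (by simpa [Fin.ext_iff] using h1) (by simpa [Fin.ext_iff] using h2)

theorem castSucc_eq_succ {i j : Fin n} (h : j.val = i.val + 1) : j.castSucc = i.succ :=
  Fin.ext (by simp [h])

/-- The permutations of `{0, …, n}` attached to the generators of type `B_n`. -/
def bSwap (i : Fin n) : Equiv.Perm (Fin (n + 1)) := if i.val = 0 then 1 else adjSwap i

theorem braid_of_mul_pow_three {G : Type*} [Group G] {a b : G} (ha : a * a = 1) (hb : b * b = 1)
    (h : (a * b) ^ 3 = 1) : a * b * a = b * a * b := by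
  have h1 : (a * b * a) * (b * a * b) = 1 := by
    rw [← h]; simp only [pow_succ, pow_zero]; group
  rw [eq_inv_of_mul_eq_one_left h1, mul_inv_rev, mul_inv_rev, ← eq_inv_of_mul_eq_one_left ha,
    ← eq_inv_of_mul_eq_one_left hb, mul_assoc]

/-! ### Uniqueness of the Juyumaya map. -/

namespace IsBtoA

variable {J : JuyumayaMap cs ct} (hJ : IsBtoA J)
include hJ

theorem permHom_φ_simple (i : Fin n) : permHom ct (J.φ (cs.simple i)) = bSwap i := by
  rw [hJ.φ_simple, bSwap]
  split_ifs
  · exact map_one _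
  · exact permHom_simple ct i

theorem e_eq_rankOne (i : Fin n) : J.e i = rankOne ct i := by
  obtain ⟨k, hk⟩ := i
  induction k with
  | zero => exact hJ.e_representative _ (Nat.zero_le 1)
  | succ k ih =>
    -- The bond between s_1 and s_2 has order 4 and does not make them conjugate, so the value at
    -- s_2 is part of the data. From there on all bonds have order 3, and s_i s_{i+1} conjugates s_i
    -- to s_{i+1}.
    rcases Nat.eq_zero_or_pos k with rfl | hpos
    · exact hJ.e_representative _ le_rfl
    set i : Fin n := ⟨k, Nat.lt_of_succ_lt hk⟩ with hi
    set j : Fin n := ⟨k + 1, hk⟩ with hj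
    have hij : j.val = i.val + 1 := rfl
    have hm : typeB n i j = 3 := by
      rw [typeB_apply, if_neg (by simp [hi, hj]), if_neg (by simp [hi, hj]; omega),
        if_pos (by simp [hi, hj])]
    have h3 := cs.simple_mul_simple_pow i j
    rw [hm] at h3
    have hconj : (cs.simple i * cs.simple j) * cs.simple i * (cs.simple i * cs.simple j)⁻¹ =
        cs.simple j := by
      rw [mul_inv_eq_iff_eq_mul, ← mul_assoc]
      exact braid_of_mul_pow_three (cs.simple_mul_simple_self i) (cs.simple_mul_simple_self j) h3
    rw [← J.equivariant _ i j hconj, ih (Nat.lt_of_succ_lt hk), rankOne_eq_pairSub,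
      rankOne_eq_pairSub, smul_pairSub, map_mul, map_mul, hJ.permHom_φ_simple,
      hJ.permHom_φ_simple, bSwap, bSwap, if_neg hpos.ne', if_neg (Nat.succ_ne_zero k),
      Equiv.Perm.mul_apply, Equiv.Perm.mul_apply, ← castSucc_eq_succ hij, adjSwap_castSucc,
      adjSwap_of_ne j (by simp [hj]) (by simp [hj]; omega), adjSwap_castSucc,
      adjSwap_of_ne i (by simp [hi, hj]; omega) (by simp [hi, hj]), castSucc_eq_succ hij]

theorem e_eq_pairSub (i : Fin n) : J.e i = pairSub ct i.castSucc i.succ := by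
  rw [hJ.e_eq_rankOne, rankOne_eq_pairSub]

theorem eq_of_isBtoA {J' : JuyumayaMap cs ct} (hJ' : IsBtoA J') : J = J' := by
  refine JuyumayaMap.ext (cs.ext_simple fun i => ?_) (funext fun i => ?_)
  · rw [hJ.φ_simple, hJ'.φ_simple]
  · rw [hJ.e_eq_rankOne, hJ'.e_eq_rankOne]

end IsBtoA

/-! ### Existence -/

variable (cs ct)

/-- The images of the generators of type `B_n` in the Coxeter group of type `A_n`. -/
def bToA (i : Fin n) : U := if i.val = 0 then 1 else ct.simple i

/-- The bonds at s_1 are even (4 or 2), so after s_1 is sent to 1 they only require an even power of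
t_j to be trivial. The other bonds agree with those of `A_n`. -/
theorem bToA_isLiftable : (typeB n).IsLiftable (bToA ct) := by
  intro i j
  rcases eq_or_ne i j with rfl | hij
  · rw [(typeB n).diagonal, pow_one, bToA]
    split_ifs <;> simp
  have hij' : i.val ≠ j.val := fun h => hij (Fin.ext h)
  by_cases hi : i.val = 0
  · have hj : j.val ≠ 0 := by omega
    have h : Even (typeB n i j) := by
      rw [typeB_apply]
      split_ifs <;> first | (exfalso; omega) | decide
    obtain ⟨k, hk⟩ := h
    rw [bToA, bToA, if_pos hi, if_neg hj, one_mul, hk, ← two_mul, pow_mul, ct.simple_sq, one_pow]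
  by_cases hj : j.val = 0
  · have h : Even (typeB n i j) := by
      rw [typeB_apply]
      split_ifs <;> first | (exfalso; omega) | decide
    obtain ⟨k, hk⟩ := h
    rw [bToA, bToA, if_neg hi, if_pos hj, mul_one, hk, ← two_mul, pow_mul, ct.simple_sq, one_pow]
  · have h : typeB n i j = CoxeterMatrix.A n i j := by
      rw [typeB_apply, typeA_apply]
      split_ifs <;> first | rfl | (exfalso; omega)
    rw [bToA, bToA, if_neg hi, if_neg hj, h, ct.simple_mul_simple_pow]

/-- The homomorphism from type `B_n` to type `A_n` that kills the first generator. -/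
def bToAHom : W →* U := cs.lift ⟨bToA ct, bToA_isLiftable ct⟩

theorem bToAHom_simple (i : Fin n) : bToAHom cs ct (cs.simple i) = bToA ct i :=
  cs.lift_apply_simple (bToA_isLiftable ct) i

/-- A permutation of the points, acting on signed points. -/
def signedPerm (n : ℕ) : Equiv.Perm (Fin (n + 1)) →* Equiv.Perm (Fin (n + 1) × Bool) where
  toFun σ := Equiv.prodCongr σ (Equiv.refl Bool)
  map_one' := rfl
  map_mul' _ _ := rfl

theorem signedPerm_apply (σ : Equiv.Perm (Fin (n + 1))) (p : Fin (n + 1) × Bool) :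
    signedPerm n σ p = (σ p.1, p.2) := rfl

/-- The sign change at a point. -/
def signFlip (a : Fin (n + 1)) : Equiv.Perm (Fin (n + 1) × Bool) :=
  Function.Involutive.toPerm (fun p => (p.1, if p.1 = a then !p.2 else p.2)) (by
    rintro ⟨b, s⟩
    by_cases h : b = a <;> simp [h])

theorem signFlip_apply (a : Fin (n + 1)) (p : Fin (n + 1) × Bool) :
    signFlip a p = (p.1, if p.1 = a then !p.2 else p.2) := rfl

theorem signFlip_mul_self (a : Fin (n + 1)) : signFlip a * signFlip a = 1 := by
  ext1 ⟨b, s⟩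
  by_cases h : b = a <;> simp [signFlip_apply, h]

theorem signFlip_commute (a b : Fin (n + 1)) :
    signFlip a * signFlip b = signFlip b * signFlip a := by
  ext1 ⟨c, s⟩
  simp only [signFlip_apply, Equiv.Perm.mul_apply]
  split_ifs <;> rfl

theorem signedPerm_mul_signFlip (σ : Equiv.Perm (Fin (n + 1))) (a : Fin (n + 1)) :
    signedPerm n σ * signFlip a = signFlip (σ a) * signedPerm n σ := by
  ext1 ⟨c, s⟩
  simp [signFlip_apply, signedPerm_apply]

theorem signFlip_injective : Function.Injective (signFlip (n := n)) := by
  intro a b h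
  by_contra hab
  have := congrArg Prod.snd (Equiv.congr_fun h (a, true))
  simp [signFlip_apply, hab] at this

/-- The signed permutations attached to the generators of type `B_n`. -/
def bSigned (i : Fin n) : Equiv.Perm (Fin (n + 1) × Bool) :=
  if i.val = 0 then signFlip i.succ else signedPerm n (adjSwap i)

theorem mul_pow_four_of_braid {G : Type*} [Group G] {a b : G} (ha : a * a = 1) (hb : b * b = 1)
    (h : a * (b * a * b) = (b * a * b) * a) : (a * b) ^ 4 = 1 := by
  have h1 : (a * b) ^ 2 * (b * a) ^ 2 = 1 := by
    calc (a * b) ^ 2 * (b * a) ^ 2 = a * b * a * (b * b) * a * b * a := by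
          simp only [pow_two]; group
      _ = a * b * (a * a) * b * a := by rw [hb]; group
      _ = 1 := by rw [ha, mul_one, mul_assoc a, hb, mul_one, ha]
  calc (a * b) ^ 4 = (a * b) ^ 2 * (a * (b * a * b)) := by simp only [pow_succ, pow_zero]; group
    _ = (a * b) ^ 2 * (b * a) ^ 2 := by rw [h]; simp only [pow_succ, pow_zero]; group
    _ = 1 := h1

theorem mul_pow_swap {G : Type*} [Group G] {a b : G} (ha : a * a = 1) (hb : b * b = 1) {k : ℕ}
    (h : (a * b) ^ k = 1) : (b * a) ^ k = 1 := by
  have : b * a = (a * b)⁻¹ := by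
    rw [mul_inv_rev, ← eq_inv_of_mul_eq_one_left hb, ← eq_inv_of_mul_eq_one_left ha]
  rw [this, inv_pow, h, inv_one]

theorem bSigned_mul_self (i : Fin n) : bSigned i * bSigned i = 1 := by
  rw [bSigned]
  split_ifs
  · exact signFlip_mul_self _
  · rw [← map_mul, adjSwap_mul_self, map_one]

theorem bSigned_isLiftable : (typeB n).IsLiftable (bSigned (n := n)) := by
  have hzero : ∀ i j : Fin n, i.val = 0 → j.val ≠ 0 →
      (bSigned i * bSigned j) ^ (typeB n i j) = 1 := by
    intro i j hi hj
    have hne : i ≠ j := fun h => hj (h ▸ hi)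
    have hb : bSigned j = signedPerm n (adjSwap j) := if_neg hj
    have ha : bSigned i = signFlip i.succ := if_pos hi
    rcases eq_or_ne j.val 1 with hj1 | hj1
    · rw [typeB_apply, if_neg hne, if_pos (Or.inl ⟨hi, hj1⟩)]
      refine mul_pow_four_of_braid (bSigned_mul_self i) (bSigned_mul_self j) ?_
      have : bSigned j * bSigned i * bSigned j = signFlip (adjSwap j i.succ) := by
        rw [ha, hb, signedPerm_mul_signFlip, mul_assoc, ← map_mul, adjSwap_mul_self, map_one,
          mul_one]
      rw [this, ha, signFlip_commute]
    · rw [typeB_apply, if_neg hne, if_neg (by omega), if_neg (by omega)]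
      refine mul_pow_two_of_commute (bSigned_mul_self i) (bSigned_mul_self j) ?_
      rw [ha, hb, signedPerm_mul_signFlip, adjSwap_of_ne j] <;> simp <;> omega
  intro i j
  rcases eq_or_ne i j with rfl | hij
  · rw [(typeB n).diagonal, pow_one, bSigned_mul_self]
  have hij' : i.val ≠ j.val := fun h => hij (Fin.ext h)
  by_cases hi : i.val = 0
  · exact hzero i j hi (by omega)
  by_cases hj : j.val = 0
  · rw [← (typeB n).symmetric]
    exact mul_pow_swap (bSigned_mul_self j) (bSigned_mul_self i) (hzero j i hj hi)
  · have h : typeB n i j = CoxeterMatrix.A n i j := by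
      rw [typeB_apply, typeA_apply]
      split_ifs <;> first | rfl | (exfalso; omega)
    rw [bSigned, bSigned, if_neg hi, if_neg hj, h, ← map_mul, ← map_pow, adjSwap_isLiftable i j,
      map_one]

/-- The signed permutation attached to an element of a Coxeter group of type `B_n`. -/
def bSignedHom : W →* Equiv.Perm (Fin (n + 1) × Bool) :=
  cs.lift ⟨bSigned, bSigned_isLiftable⟩

theorem bSignedHom_simple (i : Fin n) : bSignedHom cs (cs.simple i) = bSigned i :=
  cs.lift_apply_simple bSigned_isLiftable i

/-- Sign changes commute with one another and are carried along by permutations. Conjugation of s_1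
in W thus determines how φ(g) moves the point 1, information that is lost when φ is applied to g s_1
g⁻¹. -/
theorem bSignedHom_mul_signFlip (g : W) (a : Fin (n + 1)) :
    bSignedHom cs g * signFlip a =
      signFlip (permHom ct (bToAHom cs ct g) a) * bSignedHom cs g := by
  induction g using cs.simple_induction_left with
  | one => simp
  | mul_simple_left g i ih =>
    rw [map_mul, mul_assoc, ih, ← mul_assoc, ← mul_assoc]
    congr 1
    rw [bSignedHom_simple, map_mul, map_mul, bToAHom_simple, bSigned, bToA]
    split_ifs
    · simp [signFlip_commute]
    · rw [signedPerm_mul_signFlip, permHom_simple]; rfl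

theorem permHom_bToAHom_zero (g : W) : permHom ct (bToAHom cs ct g) 0 = 0 := by
  induction g using cs.simple_induction_left with
  | one => simp
  | mul_simple_left g i ih =>
    rw [map_mul, map_mul, Equiv.Perm.mul_apply, ih, bToAHom_simple, bToA]
    split_ifs with h
    · simp
    · rw [permHom_simple, adjSwap_of_ne i (by simpa using Ne.symm h) (by simp)]

theorem adjSwap_ne_one (i : Fin n) : adjSwap i ≠ 1 := fun h =>
  (Fin.castSucc_lt_succ (i := i)).ne (by rw [← adjSwap_castSucc, h]; rfl)

/-- If both generators are s_1, then conjugation preserves the sign change at 1, so φ(g) fixes the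
point 1; it always fixes 0. If exactly one is s_1, applying φ would give t_k = 1 for some k.
Otherwise φ(g) conjugates one transposition to another and so carries the unordered pair of the
first to that of the second. -/
theorem bToAHom_smul_rankOne (g : W) (i j : Fin n) (h : g * cs.simple i * g⁻¹ = cs.simple j) :
    bToAHom cs ct g • rankOne ct i = rankOne ct j := by
  have h1 := congrArg (bToAHom cs ct) h
  rw [map_mul, map_mul, map_inv, bToAHom_simple, bToAHom_simple] at h1
  have hne : ∀ k, ct.simple k ≠ 1 := fun k hk => adjSwap_ne_one k (by
    rw [← permHom_simple ct, hk, map_one])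
  rw [rankOne_eq_pairSub, rankOne_eq_pairSub, smul_pairSub]
  by_cases hi : i.val = 0
  · by_cases hj : j.val = 0
    · obtain rfl : i = j := Fin.ext (hi.trans hj.symm)
      have h2 := bSignedHom_mul_signFlip cs ct g i.succ
      have h3 := congrArg (bSignedHom cs) h
      rw [map_mul, map_mul, map_inv, bSignedHom_simple, bSigned, if_pos hi, h2,
        mul_inv_cancel_right] at h3
      have h0 : i.castSucc = 0 := Fin.ext (by simpa using hi)
      rw [signFlip_injective h3, h0, permHom_bToAHom_zero]
    · rw [bToA, if_pos hi, mul_one, mul_inv_cancel, bToA, if_neg hj] at h1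
      exact absurd h1.symm (hne j)
  · by_cases hj : j.val = 0
    · rw [bToA, bToA, if_neg hi, if_pos hj, mul_inv_eq_one, mul_eq_left] at h1
      exact absurd h1 (hne i)
    · rw [bToA, bToA, if_neg hi, if_neg hj] at h1
      have h2 := congrArg (permHom ct) h1
      rw [map_mul, map_mul, map_inv, permHom_simple, permHom_simple, adjSwap,
        ← Equiv.swap_apply_apply, adjSwap] at h2
      have h3 := Equiv.congr_fun h2 j.castSucc
      rw [Equiv.swap_apply_left, Equiv.swap_apply_def] at h3
      split_ifs at h3 with hc hd
      · rw [← hc, h3]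
      · rw [← hd, h3, pairSub_comm]
      · exact absurd h3 (Fin.castSucc_lt_succ (i := j)).ne

/-- The Juyumaya map from type `B_n` to type `A_n`. -/
def bToAJuyumaya : JuyumayaMap cs ct where
  φ := bToAHom cs ct
  e := rankOne ct
  equivariant := bToAHom_smul_rankOne cs ct
  mul_eq s t g := by
    rw [map_mul, bToAHom_simple, bToA]
    split_ifs
    · rw [one_mul]
    · rw [mul_smul, rankOne_eq_pairSub, rankOne_eq_pairSub, smul_pairSub, smul_pairSub,
        permHom_simple, adjSwap, pairSub_mul_pairSub_swap]

theorem bToAJuyumaya_isBtoA : IsBtoA (bToAJuyumaya cs ct) where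
  φ_simple := bToAHom_simple cs ct
  e_representative _ _ := rfl

theorem existsUnique_isBtoA : ∃! J : JuyumayaMap cs ct, IsBtoA J :=
  ⟨_, bToAJuyumaya_isBtoA cs ct, fun _ hJ => hJ.eq_of_isBtoA (bToAJuyumaya_isBtoA cs ct)⟩

end BtoA

/-! ## Generators and universal property of Marin rings -/

section MarinRing

variable {B : Type u} {M : CoxeterMatrix B} {W : Type v} [Group W]

theorem ArtinGroup.closure_range_gen : Subgroup.closure (Set.range (ArtinGroup.gen M)) = ⊤ :=
  PresentedGroup.closure_range_of _

theorem ArtinGroup.induction {p : ArtinGroup M → Prop} (z : ArtinGroup M) (one : p 1)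
    (mul_gen : ∀ s z, p z → p (gen M s * z)) (mul_gen_inv : ∀ s z, p z → p ((gen M s)⁻¹ * z)) :
    p z := by
  have hz : z ∈ Subgroup.closure (Set.range (ArtinGroup.gen M)) := by
    rw [ArtinGroup.closure_range_gen]; trivial
  induction hz using Subgroup.closure_induction_left with
  | one => exact one
  | mul_left x hx y _ ih => obtain ⟨s, rfl⟩ := hx; exact mul_gen s y ih
  | inv_mul_cancel x hx y _ ih => obtain ⟨s, rfl⟩ := hx; exact mul_gen_inv s y ih

/-- The homomorphism from the Artin group defined by a family that satisfies the braid relations. -/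
def ArtinGroup.lift {G : Type*} [Group G] (f : B → G)
    (hf : ∀ s t, ((CoxeterSystem.alternatingWord s t (M s t)).map f).prod =
      ((CoxeterSystem.alternatingWord t s (M s t)).map f).prod) : ArtinGroup M →* G :=
  PresentedGroup.toGroup (f := f) (by
    rintro _ ⟨s, t, rfl⟩
    have hl : ∀ l : List B, FreeGroup.lift f (l.map FreeGroup.of).prod = (l.map f).prod := by
      intro l
      rw [map_list_prod, List.map_map]
      congr 1
      exact List.map_congr_left fun a _ => by simp
    rw [map_mul, map_inv, hl, hl, hf, mul_inv_cancel])

theorem ArtinGroup.lift_gen {G : Type*} [Group G] (f : B → G)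
    (hf : ∀ s t, ((CoxeterSystem.alternatingWord s t (M s t)).map f).prod =
      ((CoxeterSystem.alternatingWord t s (M s t)).map f).prod) (s : B) :
    ArtinGroup.lift f hf (ArtinGroup.gen M s) = f s :=
  PresentedGroup.toGroup.of _

theorem ArtinGroup.prod_alternatingWord_eq (s t : B) :
    ((CoxeterSystem.alternatingWord s t (M s t)).map (ArtinGroup.gen M)).prod =
      ((CoxeterSystem.alternatingWord t s (M s t)).map (ArtinGroup.gen M)).prod := by
  have h : (PresentedGroup.mk {r : FreeGroup B | ∃ s t : B,
      r = ((CoxeterSystem.alternatingWord s t (M s t)).map FreeGroup.of).prod *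
        ((CoxeterSystem.alternatingWord t s (M s t)).map FreeGroup.of).prod⁻¹})
      (((CoxeterSystem.alternatingWord s t (M s t)).map FreeGroup.of).prod *
        ((CoxeterSystem.alternatingWord t s (M s t)).map FreeGroup.of).prod⁻¹) = 1 :=
    PresentedGroup.one_of_mem ⟨s, t, rfl⟩
  rw [map_mul, map_inv, mul_inv_eq_one, map_list_prod, map_list_prod, List.map_map,
    List.map_map] at h
  exact h

namespace MarinDatum

variable {k : Type w} {cs : CoxeterSystem M W} {A : Type x} [CommRing k] [CommRing A] [Algebra k A]
variable (D : MarinDatum k cs A)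

theorem single_one_one : D.single 1 1 = 1 := rfl

/-- The inclusion of the coefficient ring in the Marin ring. -/
def coeffHom : A →ₐ[k] D.MarinRing :=
  D.toMarinRing.comp (AlgHom.ofLinearMap
    { toFun := D.single 1
      map_add' := SkewMonoidAlgebra.single_add 1
      map_smul' := fun r c => (D.smul_single r 1 c).symm }
    rfl
    fun c c' => by
      change D.single 1 (c * c') = D.single 1 c * D.single 1 c'
      rw [single_mul_single, map_one, map_one, mul_one]; rfl)

theorem coeffHom_apply (c : A) : D.coeffHom c = D.coeff c := rfl

/-- The map from the Artin group to the Marin ring. -/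
def artinHom : ArtinGroup M →* D.MarinRing where
  toFun g := D.toMarinRing (D.single g 1)
  map_one' := map_one D.toMarinRing
  map_mul' g g' := by rw [← map_mul, single_mul_single, map_one, mul_one]

theorem artinHom_gen (s : B) : D.artinHom (ArtinGroup.gen M s) = D.g s := rfl

theorem toMarinRing_single (g : ArtinGroup M) (c : A) :
    D.toMarinRing (D.single g c) = D.coeffHom c * D.artinHom g := by
  change _ = D.toMarinRing _ * D.toMarinRing _
  rw [← map_mul]
  change _ = D.toMarinRing (D.single 1 c * D.single g 1)
  rw [single_mul_single, one_mul, map_one, mul_one]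

theorem artinHom_mul_coeffHom (g : ArtinGroup M) (c : A) :
    D.artinHom g * D.coeffHom c = D.coeffHom (D.ρ (ArtinGroup.proj cs g) c) * D.artinHom g := by
  rw [← toMarinRing_single]
  change D.toMarinRing (D.single g 1) * D.toMarinRing (D.single 1 c) = _
  rw [← map_mul, single_mul_single, one_mul, mul_one]

theorem g_mul_g (s : B) :
    D.g s * D.g s = D.coeffHom (D.a s) + D.coeffHom (1 - D.a s) * D.g s := by
  have h : D.toMarinRing _ = D.toMarinRing _ :=
    RingQuot.mkAlgHom_rel k (HeckeRel.quadratic (D := D) s)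
  rw [map_mul, map_add, map_mul] at h
  exact h

/-- Multiplying the quadratic relation by the inverse of g_s gives g_s = a_s g_s⁻¹ + (1 - a_s), and
a_s is a unit. So inverses of generators lie in the algebra generated by the g_s and the
coefficients. -/
theorem artinHom_gen_inv (s : B) : D.artinHom (ArtinGroup.gen M s)⁻¹ =
    D.coeffHom ((D.a s)⁻¹ : Aˣ) * (D.g s - D.coeffHom (1 - D.a s)) := by
  have h1 : D.g s * D.artinHom (ArtinGroup.gen M s)⁻¹ = 1 := by
    rw [← artinHom_gen, ← map_mul, mul_inv_cancel, map_one]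
  have h2 : D.coeffHom ((D.a s)⁻¹ : Aˣ) * D.coeffHom (D.a s) = 1 := by
    rw [← map_mul, Units.inv_mul, map_one]
  have h3 := congrArg (· * D.artinHom (ArtinGroup.gen M s)⁻¹) (D.g_mul_g s)
  simp only [add_mul, mul_assoc, h1, mul_one] at h3
  rw [eq_sub_of_add_eq h3.symm |>.symm, ← mul_assoc, h2, one_mul]

theorem eq_top_of_mem {S : Subalgebra k D.MarinRing} (hcoeff : ∀ c, D.coeffHom c ∈ S)
    (hg : ∀ s, D.g s ∈ S) : S = ⊤ := by
  have hartin : ∀ z, D.artinHom z ∈ S := by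
    intro z
    induction z using ArtinGroup.induction with
    | one => rw [map_one]; exact one_mem S
    | mul_gen s z ih => rw [map_mul]; exact mul_mem (hg s) ih
    | mul_gen_inv s z ih =>
      rw [map_mul, artinHom_gen_inv]
      exact mul_mem (mul_mem (hcoeff _) (sub_mem (hg s) (hcoeff _))) ih
  refine Algebra.eq_top_iff.2 fun z => ?_
  obtain ⟨z, rfl⟩ := RingQuot.mkAlgHom_surjective k D.HeckeRel z
  change D.toMarinRing z ∈ S
  induction z using D.semidirect_induction with
  | single g c => rw [toMarinRing_single]; exact mul_mem (hcoeff c) (hartin g)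
  | add z z' h h' => rw [map_add]; exact add_mem h h'

/-! ### Universal property of the Marin ring. -/

variable {H : Type y} [Ring H] [Algebra k H]

/-- The ring homomorphism from the semidirect product defined by compatible homomorphisms from the
coefficient ring and the Artin group. -/
def semidirectRingLift (f : A →ₐ[k] H) (g : ArtinGroup M →* H)
    (h : ∀ c z, f (D.ρ (ArtinGroup.proj cs z) c) * g z = g z * f c) : D.Semidirect →+* H :=
  letI := D.artinAction
  SkewMonoidAlgebra.liftNCRingHom (f : A →+* H) g (fun {c z} => h c z)

theorem semidirectRingLift_single (f : A →ₐ[k] H) (g : ArtinGroup M →* H)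
    (h : ∀ c z, f (D.ρ (ArtinGroup.proj cs z) c) * g z = g z * f c) (z : ArtinGroup M) (c : A) :
    D.semidirectRingLift f g h (D.single z c) = f c * g z :=
  SkewMonoidAlgebra.liftNC_single _ _ _ _

/-- The algebra homomorphism from the semidirect product defined by compatible homomorphisms from
the coefficient ring and the Artin group. -/
def semidirectLift (f : A →ₐ[k] H) (g : ArtinGroup M →* H)
    (h : ∀ c z, f (D.ρ (ArtinGroup.proj cs z) c) * g z = g z * f c) : D.Semidirect →ₐ[k] H where
  __ := D.semidirectRingLift f g h
  commutes' r := by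
    change D.semidirectRingLift f g h _ = _
    rw [Algebra.algebraMap_eq_smul_one, ← single_one_one, smul_single, semidirectRingLift_single,
      map_smul, map_one, map_one, mul_one, Algebra.algebraMap_eq_smul_one]

theorem semidirectLift_single (f : A →ₐ[k] H) (g : ArtinGroup M →* H)
    (h : ∀ c z, f (D.ρ (ArtinGroup.proj cs z) c) * g z = g z * f c) (z : ArtinGroup M) (c : A) :
    D.semidirectLift f g h (D.single z c) = f c * g z :=
  D.semidirectRingLift_single f g h z c

/-- The universal property of a Marin ring. -/
def lift (f : A →ₐ[k] H) (g : ArtinGroup M →* H)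
    (h : ∀ c z, f (D.ρ (ArtinGroup.proj cs z) c) * g z = g z * f c)
    (hquad : ∀ s, g (ArtinGroup.gen M s) * g (ArtinGroup.gen M s) =
      f (D.a s) + f (1 - D.a s) * g (ArtinGroup.gen M s)) : D.MarinRing →ₐ[k] H :=
  RingQuot.liftAlgHom k ⟨D.semidirectLift f g h, by
    rintro _ _ ⟨s⟩
    simp only [map_mul, map_add, semidirectLift_single, map_one, one_mul, mul_one]
    rw [hquad, map_sub, map_one]⟩

theorem lift_toMarinRing (f : A →ₐ[k] H) (g : ArtinGroup M →* H)
    (h : ∀ c z, f (D.ρ (ArtinGroup.proj cs z) c) * g z = g z * f c)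
    (hquad : ∀ s, g (ArtinGroup.gen M s) * g (ArtinGroup.gen M s) =
      f (D.a s) + f (1 - D.a s) * g (ArtinGroup.gen M s)) (z : ArtinGroup M) (c : A) :
    D.lift f g h hquad (D.toMarinRing (D.single z c)) = f c * g z :=
  (RingQuot.liftAlgHom_mkAlgHom_apply k _ _ _).trans (D.semidirectLift_single f g h z c)

theorem lift_g (f : A →ₐ[k] H) (g : ArtinGroup M →* H)
    (h : ∀ c z, f (D.ρ (ArtinGroup.proj cs z) c) * g z = g z * f c)
    (hquad : ∀ s, g (ArtinGroup.gen M s) * g (ArtinGroup.gen M s) =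
      f (D.a s) + f (1 - D.a s) * g (ArtinGroup.gen M s)) (s : B) :
    D.lift f g h hquad (D.g s) = g (ArtinGroup.gen M s) := by
  rw [MarinDatum.g, lift_toMarinRing, map_one, one_mul]

theorem lift_coeff (f : A →ₐ[k] H) (g : ArtinGroup M →* H)
    (h : ∀ c z, f (D.ρ (ArtinGroup.proj cs z) c) * g z = g z * f c)
    (hquad : ∀ s, g (ArtinGroup.gen M s) * g (ArtinGroup.gen M s) =
      f (D.a s) + f (1 - D.a s) * g (ArtinGroup.gen M s)) (c : A) :
    D.lift f g h hquad (D.coeff c) = f c := by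
  rw [MarinDatum.coeff, lift_toMarinRing, map_one, mul_one]

end MarinDatum

end MarinRing

/-! ## Ties in the Marin ring of a Juyumaya map -/

section Ties

variable {n : ℕ} {W : Type v} [Group W] {U : Type w} [Group U]
variable {cs : CoxeterSystem (typeB n) W} {ct : CoxeterSystem (CoxeterMatrix.A n) U}
variable (J : JuyumayaMap cs ct)
variable {R : Type y} [CommRing R] (u : Fin n → Rˣ)
  (hu : ∀ (g : W) (s t : Fin n), g * cs.simple s * g⁻¹ = cs.simple t → u s = u t)

namespace JuyumayaMap

theorem tieImage_mul (Ψ Ψ' : J.tieMonoid) :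
    J.tieImage u hu (Ψ * Ψ') = J.tieImage u hu Ψ * J.tieImage u hu Ψ' := by
  simp only [tieImage, ← MarinDatum.coeffHom_apply, map_mul]

theorem tieImage_one : J.tieImage u hu 1 = 1 := by
  simp only [tieImage, ← MarinDatum.coeffHom_apply, map_one]

theorem marinDatum_ρ_of (g : W) (Ψ : J.tieMonoid) :
    (J.marinDatum u hu).ρ g (MonoidAlgebra.of R J.tieMonoid Ψ) =
      MonoidAlgebra.of R J.tieMonoid (J.tieAction g Ψ) := by
  simp [marinDatum, MonoidAlgebra.domCongrAut, MonoidAlgebra.domCongr]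

theorem artinHom_mul_tieImage (z : ArtinGroup (typeB n)) (Ψ : J.tieMonoid) :
    (J.marinDatum u hu).artinHom z * J.tieImage u hu Ψ =
      J.tieImage u hu (J.tieAction (ArtinGroup.proj cs z) Ψ) * (J.marinDatum u hu).artinHom z := by
  rw [tieImage, ← MarinDatum.coeffHom_apply, MarinDatum.artinHom_mul_coeffHom, marinDatum_ρ_of]
  rfl

theorem g_mul_tieImage (i : Fin n) (Ψ : J.tieMonoid) :
    (J.marinDatum u hu).g i * J.tieImage u hu Ψ =
      J.tieImage u hu (J.tieAction (cs.simple i) Ψ) * (J.marinDatum u hu).g i := by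
  rw [← MarinDatum.artinHom_gen, artinHom_mul_tieImage, ArtinGroup.proj_gen]

theorem coeffHom_a (i : Fin n) : (J.marinDatum u hu).coeffHom ((J.marinDatum u hu).a i) =
    1 + ((u i : R) - 1) • J.tieImage u hu (J.tie i) := by
  change (J.marinDatum u hu).coeffHom (J.hat i (u i)) = _
  rw [hat, map_add, map_one, map_smul]
  rfl

theorem coeffHom_a_inv (i : Fin n) :
    (J.marinDatum u hu).coeffHom (((J.marinDatum u hu).a i)⁻¹ : (J.TieAlgebra R)ˣ) =
      1 + (((u i)⁻¹ : Rˣ) - 1 : R) • J.tieImage u hu (J.tie i) := by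
  change (J.marinDatum u hu).coeffHom (J.hat i ((u i)⁻¹ : Rˣ)) = _
  rw [hat, map_add, map_one, map_smul]
  rfl

theorem adjoin_eq_top : Algebra.adjoin R
    (Set.range (fun i : Fin n => (J.marinDatum u hu).g i) ∪
      Set.range (fun i : Fin n => J.tieImage u hu (J.tie i)) ∪
      Set.range (fun i : Fin n => J.tieImage u hu (fTie J i))) = ⊤ := by
  set S := Algebra.adjoin R
    (Set.range (fun i : Fin n => (J.marinDatum u hu).g i) ∪
      Set.range (fun i : Fin n => J.tieImage u hu (J.tie i)) ∪
      Set.range (fun i : Fin n => J.tieImage u hu (fTie J i))) with hS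
  have hg : ∀ i, (J.marinDatum u hu).g i ∈ S := fun i =>
    Algebra.subset_adjoin (Or.inl (Or.inl ⟨i, rfl⟩))
  have he : ∀ i, J.tieImage u hu (J.tie i) ∈ S := fun i =>
    Algebra.subset_adjoin (Or.inl (Or.inr ⟨i, rfl⟩))
  have hginv : ∀ i, (J.marinDatum u hu).artinHom (ArtinGroup.gen (typeB n) i)⁻¹ ∈ S := by
    intro i
    rw [MarinDatum.artinHom_gen_inv, map_sub, map_one, coeffHom_a, coeffHom_a_inv]
    exact mul_mem (add_mem (one_mem S) (S.smul_mem (he i) _))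
      (sub_mem (hg i) (sub_mem (one_mem S) (add_mem (one_mem S) (S.smul_mem (he i) _))))
  -- Each tie w.e_i is a conjugate of e_i by a product of g's, whose inverses were just shown to lie
  -- in the subalgebra. The f_i play no part here: the g_i and e_i already generate.
  have horbit : ∀ (w : W) (i : Fin n), J.tieImage u hu (J.tieAction w (J.tie i)) ∈ S := by
    intro w i
    induction w using cs.simple_induction_left with
    | one => rw [map_one]; exact he i
    | mul_simple_left w j ih =>
      have h1 := J.g_mul_tieImage u hu j (J.tieAction w (J.tie i))
      rw [← MulAut.mul_apply, ← map_mul] at h1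
      have h2 : J.tieImage u hu (J.tieAction (cs.simple j * w) (J.tie i)) =
          (J.marinDatum u hu).g j * J.tieImage u hu (J.tieAction w (J.tie i)) *
            (J.marinDatum u hu).artinHom (ArtinGroup.gen (typeB n) j)⁻¹ := by
        rw [h1, mul_assoc, ← MarinDatum.artinHom_gen, ← map_mul, mul_inv_cancel, map_one, mul_one]
      rw [h2]
      exact mul_mem (mul_mem (hg j) ih) (hginv j)
  have htie : ∀ (Ψ : RootSubsystem ct) (h : Ψ ∈ J.tieMonoid), J.tieImage u hu ⟨Ψ, h⟩ ∈ S := by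
    intro Ψ h
    induction h using Submonoid.closure_induction with
    | mem Ψ h => obtain ⟨w, i, rfl⟩ := h; exact horbit w i
    | one => exact (J.tieImage_one u hu).symm ▸ one_mem S
    | mul Ψ Ψ' hΨ hΨ' ih ih' =>
      exact (J.tieImage_mul u hu ⟨Ψ, hΨ⟩ ⟨Ψ', hΨ'⟩).symm ▸ mul_mem ih ih'
  refine (J.marinDatum u hu).eq_top_of_mem (fun c => ?_) hg
  induction c using MonoidAlgebra.induction_on with
  | of Ψ => exact htie Ψ.1 Ψ.2
  | add c c' h h' => rw [map_add]; exact add_mem h h'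
  | smul r c h => rw [map_smul]; exact S.smul_mem h r

end JuyumayaMap

end Ties

/-! ## From the braids and ties algebra to the Marin ring -/

section AlternatingWords

variable {B : Type u} {G : Type v} [Monoid G] (f : B → G) (s t : B)

theorem prod_alternatingWord_two :
    ((CoxeterSystem.alternatingWord s t 2).map f).prod = f s * f t := by
  simp [CoxeterSystem.alternatingWord]

theorem prod_alternatingWord_three :
    ((CoxeterSystem.alternatingWord s t 3).map f).prod = f t * f s * f t := by
  simp [CoxeterSystem.alternatingWord, mul_assoc]

theorem prod_alternatingWord_four :
    ((CoxeterSystem.alternatingWord s t 4).map f).prod = f s * f t * f s * f t := by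
  simp [CoxeterSystem.alternatingWord, mul_assoc]

end AlternatingWords

section TypeB

theorem typeB_eq_two {n : ℕ} {i j : Fin n} (h : 1 < gap i j) : typeB n i j = 2 := by
  rw [gap] at h
  rw [typeB_apply, if_neg (by rintro rfl; simp at h), if_neg (by omega), if_neg (by omega)]

theorem typeB_eq_three {n : ℕ} {i j : Fin n} (h : gap i j = 1) (h' : ¬ IsFirstPair i j) :
    typeB n i j = 3 := by
  rw [gap] at h
  rw [typeB_apply, if_neg (by rintro rfl; simp at h),
    if_neg (by rwa [IsFirstPair] at h'), if_pos (by omega)]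

theorem typeB_eq_four {n : ℕ} {i j : Fin n} (hi : i.val = 0) (hj : j.val = 1) :
    typeB n i j = 4 := by
  rw [typeB_apply, if_neg (by rintro rfl; omega), if_pos (Or.inl ⟨hi, hj⟩)]

variable {n : ℕ} {W : Type v} [Group W] {U : Type w} [Group U]
variable {cs : CoxeterSystem (typeB n) W} {ct : CoxeterSystem (CoxeterMatrix.A n) U}

theorem pairSub_triangle (a b c : Fin (n + 1)) :
    pairSub ct a b * pairSub ct b c = pairSub ct a c * pairSub ct b c := by
  rw [pairSub_comm a b, pairSub_comm b c, mul_comm, pairSub_mul_pairSub, pairSub_comm c a, mul_comm]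

theorem bSwap_castSucc {i : Fin n} (h : i.val ≠ 0) : bSwap i i.castSucc = i.succ := by
  rw [bSwap, if_neg h, adjSwap_castSucc]

theorem bSwap_succ {i : Fin n} (h : i.val ≠ 0) : bSwap i i.succ = i.castSucc := by
  rw [bSwap, if_neg h, adjSwap_succ]

theorem bSwap_of_val_eq_zero {i : Fin n} (h : i.val = 0) (a : Fin (n + 1)) : bSwap i a = a := by
  rw [bSwap, if_pos h, Equiv.Perm.one_apply]

theorem bSwap_of_ne (i : Fin n) {a : Fin (n + 1)} (h1 : a.val ≠ i.val)
    (h2 : a.val ≠ i.val + 1) : bSwap i a = a := by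
  rw [bSwap]
  split_ifs
  · rfl
  · exact adjSwap_of_ne i h1 h2

theorem bSwap_zero (i : Fin n) : bSwap i 0 = 0 := by
  rcases eq_or_ne i.val 0 with h | h
  · exact bSwap_of_val_eq_zero h 0
  · exact bSwap_of_ne i (by simpa using h.symm) (by simp)

/-- The edges of i and j and the image of the edge of i under s_j are the three sides of a triangle,
and any two sides generate the same subsystem. The condition on j is needed for s_j to act as a
transposition; i may be the first index. -/
theorem pairSub_mul_bSwap {i j : Fin n} (h : gap i j = 1) (hj0 : j.val ≠ 0) :
    pairSub ct i.castSucc i.succ * pairSub ct (bSwap j i.castSucc) (bSwap j i.succ) =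
      pairSub ct j.castSucc j.succ * pairSub ct i.castSucc i.succ := by
  rw [gap] at h
  rcases (by omega : j.val = i.val + 1 ∨ i.val = j.val + 1) with hij | hij
  · rw [← castSucc_eq_succ hij, bSwap_castSucc hj0,
      bSwap_of_ne j (by simp; omega) (by simp; omega), ← pairSub_mul_pairSub, mul_comm]
  · rw [castSucc_eq_succ hij, bSwap_succ hj0, bSwap_of_ne j (by simp; omega) (by simp; omega),
      pairSub_triangle, mul_comm]

theorem pairSub_mul_bSwap_self {j : Fin n} (hj0 : j.val ≠ 0) (a b : Fin (n + 1)) :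
    pairSub ct j.castSucc j.succ * pairSub ct (bSwap j a) (bSwap j b) =
      pairSub ct j.castSucc j.succ * pairSub ct a b := by
  rw [bSwap, if_neg hj0, adjSwap, pairSub_mul_pairSub_swap]

/-! ### Flores' relations in the Marin ring. -/

namespace IsBtoA

variable {J : JuyumayaMap cs ct} (hJ : IsBtoA J)
include hJ

theorem φ_smul_pairSub (i : Fin n) (a b : Fin (n + 1)) :
    J.φ (cs.simple i) • pairSub ct a b = pairSub ct (bSwap i a) (bSwap i b) := by
  rw [smul_pairSub, hJ.permHom_φ_simple]

theorem coe_tie (i : Fin n) : (J.tie i : RootSubsystem ct) = pairSub ct i.castSucc i.succ :=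
  hJ.e_eq_pairSub i

theorem coe_tieAction_simple {Ψ : J.tieMonoid} {a b : Fin (n + 1)} (h : Ψ.1 = pairSub ct a b)
    (i : Fin n) : (J.tieAction (cs.simple i) Ψ : RootSubsystem ct) =
      pairSub ct (bSwap i a) (bSwap i b) := by
  rw [← hJ.φ_smul_pairSub, ← h]; rfl

theorem coe_fTieAux (k : ℕ) (hk : k < n) :
    (fTieAux J k hk : RootSubsystem ct) = pairSub ct 0 (Fin.succ ⟨k, hk⟩) := by
  induction k with
  | zero => exact hJ.coe_tie _
  | succ k ih =>
    have h1 : (Fin.succ ⟨k, Nat.lt_of_succ_lt hk⟩ : Fin (n + 1)) =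
      Fin.castSucc ⟨k + 1, hk⟩ := rfl
    rw [fTieAux, hJ.coe_tieAction_simple (ih _), bSwap_zero, h1,
      bSwap_castSucc (Nat.succ_ne_zero k)]

theorem coe_fTie (i : Fin n) : (fTie J i : RootSubsystem ct) = pairSub ct 0 i.succ :=
  hJ.coe_fTieAux i.val i.isLt

variable {R : Type y} [CommRing R] (u : Fin n → Rˣ)
  (hu : ∀ (g : W) (s t : Fin n), g * cs.simple s * g⁻¹ = cs.simple t → u s = u t)

omit hJ in
theorem tieImage_congr {Ψ Ψ' : J.tieMonoid} (h : Ψ.1 = Ψ'.1) :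
    J.tieImage u hu Ψ = J.tieImage u hu Ψ' := congrArg _ (Subtype.ext h)

theorem g_mul_tieImage {Ψ Ψ' : J.tieMonoid} {i : Fin n} {a b : Fin (n + 1)}
    (h : Ψ.1 = pairSub ct a b) (h' : pairSub ct (bSwap i a) (bSwap i b) = Ψ'.1) :
    (J.marinDatum u hu).g i * J.tieImage u hu Ψ =
      J.tieImage u hu Ψ' * (J.marinDatum u hu).g i := by
  rw [J.g_mul_tieImage,
    tieImage_congr u hu (Ψ' := Ψ') ((hJ.coe_tieAction_simple h i).trans h')]

omit hJ in
theorem g_braid (i j : Fin n) :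
    ((CoxeterSystem.alternatingWord i j (typeB n i j)).map (J.marinDatum u hu).g).prod =
      ((CoxeterSystem.alternatingWord j i (typeB n i j)).map (J.marinDatum u hu).g).prod := by
  have h := congrArg (J.marinDatum u hu).artinHom
    (ArtinGroup.prod_alternatingWord_eq (M := typeB n) i j)
  rwa [map_list_prod, map_list_prod, List.map_map, List.map_map] at h

/-- The braid relations come from the Artin group. In a relation involving both g's and ties, every
g is pushed to the right past the ties, acting on them as s_i; what remains is an identity in the
monoid of subsystems, settled by computing images of pairs and by the triangle identities. -/
theorem respects_floresRel ⦃a b : FreeAlgebra R (Gen n)⦄ (h : FloresRel u a b) :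
    let F := FreeAlgebra.lift R fun
      | Gen.g i => (J.marinDatum u hu).g i
      | Gen.e i => J.tieImage u hu (J.tie i)
      | Gen.f i => J.tieImage u hu (fTie J i)
    F a = F b := by
  intro F
  have hg : ∀ i, F (gX i) = (J.marinDatum u hu).g i := fun i => FreeAlgebra.lift_ι_apply _ _
  have he : ∀ i, F (eX i) = J.tieImage u hu (J.tie i) := fun i => FreeAlgebra.lift_ι_apply _ _
  have hf : ∀ i, F (fX i) = J.tieImage u hu (fTie J i) := fun i => FreeAlgebra.lift_ι_apply _ _
  have hcomm : ∀ Ψ Ψ' : J.tieMonoid,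
      J.tieImage u hu Ψ * J.tieImage u hu Ψ' = J.tieImage u hu Ψ' * J.tieImage u hu Ψ := by
    intro Ψ Ψ'
    rw [← J.tieImage_mul, ← J.tieImage_mul, mul_comm]
  induction h with
  | gg i j h =>
    have h1 := g_braid (J := J) u hu i j
    rw [typeB_eq_two h, prod_alternatingWord_two, prod_alternatingWord_two] at h1
    simpa only [map_mul, hg] using h1
  | gggg i j hi hj =>
    have h1 := g_braid (J := J) u hu i j
    rw [typeB_eq_four hi hj, prod_alternatingWord_four, prod_alternatingWord_four] at h1
    simpa only [map_mul, hg] using h1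
  | ggg i j h h' =>
    have h1 := g_braid (J := J) u hu i j
    rw [typeB_eq_three h h', prod_alternatingWord_three, prod_alternatingWord_three] at h1
    simpa only [map_mul, hg] using h1.symm
  | quadratic i =>
    simp only [map_mul, map_add, map_sub, map_one, map_smul, hg, he]
    rw [MarinDatum.g_mul_g, map_sub, map_one, J.coeffHom_a, mul_sub, mul_one, smul_sub,
      ← smul_mul_assoc]
    noncomm_ring
  | ge i j h =>
    simp only [map_mul, hg, he]
    refine hJ.g_mul_tieImage u hu (hJ.coe_tie j) ((hJ.coe_tie j).trans ?_).symm
    rcases eq_or_ne i.val 0 with hi | hi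
    · rw [bSwap_of_val_eq_zero hi, bSwap_of_val_eq_zero hi]
    rcases eq_or_ne i j with rfl | hij
    · rw [bSwap_castSucc hi, bSwap_succ hi, pairSub_comm]
    · rw [gap] at h
      have hij' : i.val ≠ j.val := fun h => hij (Fin.ext h)
      rw [bSwap_of_ne i (by simp; omega) (by simp; omega),
        bSwap_of_ne i (by simp; omega) (by simp; omega)]
  | gge i j h h' =>
    simp only [map_mul, hg, he]
    rw [mul_assoc, J.g_mul_tieImage, ← mul_assoc, hJ.g_mul_tieImage u hu (Ψ' := J.tie i)
      (hJ.coe_tieAction_simple (hJ.coe_tie j) i), mul_assoc]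
    rw [gap] at h
    rw [IsFirstPair] at h'
    have hi0 : i.val ≠ 0 := by omega
    have hj0 : j.val ≠ 0 := by omega
    rw [hJ.coe_tie]
    rcases (by omega : j.val = i.val + 1 ∨ i.val = j.val + 1) with hij | hij
    · rw [castSucc_eq_succ hij, bSwap_succ hi0, bSwap_of_ne j (by simp; omega) (by simp; omega),
        bSwap_of_ne i (by simp; omega) (by simp; omega), bSwap_succ hj0, castSucc_eq_succ hij]
    · rw [← castSucc_eq_succ hij, bSwap_castSucc hi0,
        bSwap_of_ne i (by simp; omega) (by simp; omega), bSwap_castSucc hj0,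
        ← castSucc_eq_succ hij, bSwap_of_ne j (by simp; omega) (by simp; omega)]
  | ee i j =>
    simp only [map_mul, he]
    exact hcomm _ _
  | e_sq i =>
    simp only [map_mul, he]
    rw [← J.tieImage_mul, J.tie_mul_self]
  | eeg_ege i j h h' =>
    simp only [map_mul, hg, he]
    have hj0 : j.val ≠ 0 := by rw [gap] at h; rw [IsFirstPair] at h'; omega
    rw [mul_assoc (J.tieImage u hu (J.tie i)), J.g_mul_tieImage, ← mul_assoc, ← J.tieImage_mul,
      ← J.tieImage_mul]
    congr 1
    refine tieImage_congr u hu ?_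
    rw [Submonoid.coe_mul, Submonoid.coe_mul, hJ.coe_tieAction_simple (hJ.coe_tie i), hJ.coe_tie,
      hJ.coe_tie, pairSub_mul_bSwap h hj0]
  | ege_gee i j h h' =>
    simp only [map_mul, hg, he]
    have hj0 : j.val ≠ 0 := by rw [gap] at h; rw [IsFirstPair] at h'; omega
    rw [mul_assoc, J.g_mul_tieImage, ← mul_assoc,
      mul_assoc (J.tieImage u hu (J.tieAction (cs.simple j) (J.tie i))), J.g_mul_tieImage,
      ← mul_assoc, ← J.tieImage_mul, ← J.tieImage_mul]
    congr 1
    refine tieImage_congr u hu ?_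
    rw [Submonoid.coe_mul, Submonoid.coe_mul, hJ.coe_tieAction_simple (hJ.coe_tie i),
      hJ.coe_tieAction_simple (hJ.coe_tie j), hJ.coe_tie, pairSub_mul_bSwap h hj0,
      bSwap_castSucc hj0, bSwap_succ hj0, pairSub_comm j.succ, mul_comm (pairSub ct (bSwap j _) _),
      pairSub_mul_bSwap_self hj0]
  | eeg_ege_first i j hi hj =>
    simp only [map_mul, hg, he]
    rw [mul_assoc (J.tieImage u hu (J.tie j)), J.g_mul_tieImage, ← mul_assoc, ← J.tieImage_mul,
      ← J.tieImage_mul]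
    congr 1
    refine tieImage_congr u hu ?_
    rw [Submonoid.coe_mul, Submonoid.coe_mul, hJ.coe_tieAction_simple (hJ.coe_tie i), hJ.coe_tie,
      hJ.coe_tie, pairSub_mul_bSwap_self (by omega), mul_comm]
  | ege_gee_first i j hi hj =>
    have hj0 : j.val ≠ 0 := by omega
    simp only [map_mul, hg, he]
    rw [mul_assoc, J.g_mul_tieImage, ← mul_assoc,
      mul_assoc (J.tieImage u hu (J.tieAction (cs.simple j) (J.tie i))), J.g_mul_tieImage,
      ← mul_assoc, ← J.tieImage_mul, ← J.tieImage_mul]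
    congr 1
    refine tieImage_congr u hu ?_
    rw [Submonoid.coe_mul, Submonoid.coe_mul, hJ.coe_tieAction_simple (hJ.coe_tie i),
      hJ.coe_tieAction_simple (hJ.coe_tie j), hJ.coe_tie, mul_comm,
      bSwap_castSucc hj0, bSwap_succ hj0, pairSub_comm j.succ]
  | f_first i hi =>
    rw [he, hf]
    refine tieImage_congr u hu ?_
    have h0 : i.castSucc = 0 := Fin.ext (by simpa using hi)
    rw [hJ.coe_fTie, hJ.coe_tie, h0]
  | gf i j h =>
    simp only [map_mul, hg, hf]
    refine hJ.g_mul_tieImage u hu (hJ.coe_fTie j) ((hJ.coe_fTie j).trans ?_).symm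
    rcases eq_or_ne i.val 0 with hi | hi
    · rw [bSwap_of_val_eq_zero hi, bSwap_of_val_eq_zero hi]
    · simp only [ne_eq, Fin.ext_iff] at h
      rw [bSwap_zero, bSwap_of_ne i (by simp; omega) (by simp; omega)]
  | ef i j =>
    simp only [map_mul, he, hf]
    exact hcomm _ _
  | ff i j =>
    simp only [map_mul, hf]
    exact hcomm _ _
  | gf_pred i j h =>
    simp only [map_mul, hg, hf]
    refine hJ.g_mul_tieImage u hu (hJ.coe_fTie j) ((hJ.coe_fTie i).trans ?_).symm
    rw [bSwap_zero, ← castSucc_eq_succ h.symm, bSwap_castSucc (by omega)]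
  | gf_self i j h =>
    simp only [map_mul, hg, hf]
    refine hJ.g_mul_tieImage u hu (hJ.coe_fTie i) ((hJ.coe_fTie j).trans ?_).symm
    rw [bSwap_zero, bSwap_succ (by omega), castSucc_eq_succ h.symm]
  | ef_succ i j h =>
    simp only [map_mul, he, hf]
    rw [← J.tieImage_mul, ← J.tieImage_mul]
    refine tieImage_congr u hu ?_
    rw [Submonoid.coe_mul, Submonoid.coe_mul, hJ.coe_tie, hJ.coe_fTie, hJ.coe_fTie,
      castSucc_eq_succ h, mul_comm, pairSub_triangle, mul_comm]
  | ef_ff i j h =>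
    simp only [map_mul, he, hf]
    rw [← J.tieImage_mul, ← J.tieImage_mul]
    refine tieImage_congr u hu ?_
    rw [Submonoid.coe_mul, Submonoid.coe_mul, hJ.coe_tie, hJ.coe_fTie, hJ.coe_fTie,
      castSucc_eq_succ h, mul_comm, pairSub_mul_pairSub, mul_comm]

end IsBtoA

end TypeB

/-! ## Ties between arbitrary points, from ties between adjacent points -/

section ActionTies

variable {G : Type u} [Group G] {X : Type v}

/-- Elements `γ_0, …, γ_{m-1}` of a group that satisfy the braid relations of type `A_m`, and
elements `ε_0, …, ε_{m-1}` of a set with an action of the group on which the `γ_i` act as the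
adjacent transpositions act on the adjacent pairs. -/
structure IsBraidTie [MulAction G X] (m : ℕ) (γ : ℕ → G) (ε : ℕ → X) : Prop where
  commute : ∀ i j, i + 1 < j → j < m → γ i * γ j = γ j * γ i
  braid : ∀ i, i + 1 < m → γ i * γ (i + 1) * γ i = γ (i + 1) * γ i * γ (i + 1)
  fix : ∀ i j, i < m → j < m → i = j ∨ i + 1 < j ∨ j + 1 < i → γ i • ε j = ε j
  move : ∀ i, i + 1 < m → γ i • γ (i + 1) • ε i = ε (i + 1)
  sq_fix : ∀ i, i + 1 < m → γ i • γ i • ε (i + 1) = ε (i + 1)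
  sq_fix_succ : ∀ i, i + 1 < m → γ (i + 1) • γ (i + 1) • ε i = ε i

/-- The tie between the points `a` and `a + k + 1`. -/
def longTie [MulAction G X] (γ : ℕ → G) (ε : ℕ → X) (a : ℕ) : ℕ → X
  | 0 => ε a
  | k + 1 => γ (a + k + 1) • longTie γ ε a k

/-! ### Braid generators acting on ties between distant points. -/

section Basic

variable [MulAction G X] {m : ℕ} {γ : ℕ → G} {ε : ℕ → X}

theorem smul_longTie_of_commute (z : G) (a k : ℕ)
    (h : ∀ j, a < j → j ≤ a + k → z * γ j = γ j * z) (h' : z • ε a = ε a) :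
    z • longTie γ ε a k = longTie γ ε a k := by
  induction k with
  | zero => exact h'
  | succ k ih =>
    rw [longTie, smul_smul, h _ (by omega) (by omega), mul_smul,
      ih fun j hj hj' => h j hj (by omega)]

namespace IsBraidTie

variable (h : IsBraidTie m γ ε)
include h

theorem smul_of_gt (a k i : ℕ) (hi : a + k + 1 < i) (him : i < m) :
    γ i • longTie γ ε a k = longTie γ ε a k :=
  smul_longTie_of_commute _ _ _ (fun j _ hj => (h.commute j i (by omega) him).symm)
    (h.fix i a him (by omega) (by omega))

theorem smul_of_lt (a k i : ℕ) (hi : i + 1 < a) (hk : a + k < m) :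
    γ i • longTie γ ε a k = longTie γ ε a k :=
  smul_longTie_of_commute _ _ _ (fun j hj _ => h.commute i j (by omega) (by omega))
    (h.fix i a (by omega) (by omega) (by omega))

/-- The elements γ_i need not be involutions in G; this shows that the square acts trivially where
needed, by induction on the length of the tie. -/
theorem sq_smul (a k : ℕ) (hk : a + k + 1 < m) :
    γ (a + k + 1) • γ (a + k + 1) • longTie γ ε a k = longTie γ ε a k := by
  induction k with
  | zero => exact h.sq_fix_succ a hk
  | succ k ih =>
    have h1 := h.smul_of_gt a k (a + k + 2) (by omega) hk
    -- Since γ_{a+k+2} fixes the shorter tie, it may be inserted on the right, which completes a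
    -- word to which the braid relation applies.
    have h2 : γ (a + k + 2) • γ (a + k + 1) • longTie γ ε a k =
        γ (a + k + 1) • γ (a + k + 2) • γ (a + k + 1) • longTie γ ε a k := by
      conv_lhs => rw [← h1]
      simp only [smul_smul, ← mul_assoc]
      rw [h.braid (a + k + 1) hk]
    change γ (a + k + 2) • γ (a + k + 2) • γ (a + k + 1) • longTie γ ε a k = _
    rw [h2, smul_smul, smul_smul, ← h.braid (a + k + 1) hk, mul_smul, mul_smul,
      ih (by omega), h1]
    rfl

/-- Below the last two factors, γ_i commutes with the outermost one and induction applies. At the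
last but one position, the braid relation turns γ_i into a generator that fixes the shorter tie. -/
theorem smul_of_mem (a k i : ℕ) (hi : a < i) (hi' : i < a + k) (hk : a + k < m) :
    γ i • longTie γ ε a k = longTie γ ε a k := by
  induction k with
  | zero => omega
  | succ k ih =>
    rcases (by omega : i < a + k ∨ i = a + k) with h1 | rfl
    · rw [longTie, smul_smul, h.commute i _ (by omega) (by omega), mul_smul,
        ih h1 (by omega)]
    · obtain ⟨k, rfl⟩ : ∃ l, k = l + 1 := ⟨k - 1, by omega⟩
      have h1 := h.smul_of_gt a k (a + k + 2) (by omega) hk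
      change γ (a + k + 1) • γ (a + k + 2) • γ (a + k + 1) • longTie γ ε a k =
        γ (a + k + 2) • γ (a + k + 1) • longTie γ ε a k
      conv_rhs => rw [← h1]
      simp only [smul_smul, ← mul_assoc]
      rw [h.braid (a + k + 1) hk]

theorem smul_left (a k : ℕ) (hk : a + k + 1 < m) :
    γ a • longTie γ ε a (k + 1) = longTie γ ε (a + 1) k := by
  induction k with
  | zero => exact h.move a hk
  | succ k ih =>
    rw [longTie, smul_smul, h.commute a _ (by omega) (by omega), mul_smul, ih (by omega), longTie]
    congr 2
    omega

theorem smul_pred (a k : ℕ) (hk : a + 1 + k < m) :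
    γ a • longTie γ ε (a + 1) k = longTie γ ε a (k + 1) := by
  induction k with
  | zero =>
    -- Writing ε_{a+1} as γ_a γ_{a+1} ε_a in the relation γ_a γ_a ε_{a+1} = ε_{a+1} and cancelling
    -- γ_a gives γ_a ε_{a+1} = γ_{a+1} ε_a.
    have h1 := h.sq_fix a hk
    rw [← h.move a hk, smul_left_cancel_iff] at h1
    change γ a • ε (a + 1) = γ (a + 1) • ε a
    rw [← h.move a hk, h1]
  | succ k ih =>
    rw [longTie, smul_smul, h.commute a _ (by omega) (by omega), mul_smul, ih (by omega),
      longTie.eq_2 γ ε a (k + 1)]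
    congr 2
    omega

end IsBraidTie

end Basic

section Points

variable [Monoid X] [MulDistribMulAction G X] {m : ℕ} {γ : ℕ → G} {ε : ℕ → X}

/-- The tie between two points. -/
def pointTie (γ : ℕ → G) (ε : ℕ → X) (p q : ℕ) : X :=
  if p < q then longTie γ ε p (q - p - 1) else if q < p then longTie γ ε q (p - q - 1) else 1

theorem pointTie_self (p : ℕ) : pointTie γ ε p p = 1 := by simp [pointTie]

theorem pointTie_comm (p q : ℕ) : pointTie γ ε p q = pointTie γ ε q p := by
  rw [pointTie, pointTie]
  split_ifs <;> first | rfl | (exfalso; omega)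

theorem pointTie_add (p k : ℕ) : pointTie γ ε p (p + k + 1) = longTie γ ε p k := by
  rw [pointTie, if_pos (by omega)]
  congr 1
  omega

theorem pointTie_succ (p : ℕ) : pointTie γ ε p (p + 1) = ε p := pointTie_add p 0

/-- The adjacent transposition of the natural numbers `i` and `i + 1`. -/
def natSwap (i : ℕ) : Equiv.Perm ℕ := Equiv.swap i (i + 1)

theorem natSwap_apply (i p : ℕ) :
    natSwap i p = if p = i then i + 1 else if p = i + 1 then i else p :=
  Equiv.swap_apply_def _ _ _

/-- On ties the braid generators act through the symmetric group. The position of i relative to p <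
q decides: far away or strictly inside, the tie is fixed; i = q is the definition of the longer tie;
i = q - 1 undoes it because squares act trivially; i = p and i = p - 1 move the left end; and i = p
= q - 1 fixes its own edge. -/
theorem IsBraidTie.smul_pointTie (h : IsBraidTie m γ ε) {i p q : ℕ} (hi : i < m) (hp : p ≤ m)
    (hq : q ≤ m) : γ i • pointTie γ ε p q = pointTie γ ε (natSwap i p) (natSwap i q) := by
  wlog hpq : p ≤ q generalizing p q
  · rw [pointTie_comm, this hq hp (by omega), pointTie_comm]
  rcases hpq.eq_or_lt with rfl | hpq
  · rw [pointTie_self, pointTie_self, smul_one]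
  obtain ⟨k, rfl⟩ : ∃ k, q = p + k + 1 := ⟨q - p - 1, by omega⟩
  rw [pointTie_add, natSwap_apply, natSwap_apply]
  rcases lt_trichotomy i (p + k) with h1 | rfl | h1
  · rw [if_neg (by omega : p + k + 1 ≠ i), if_neg (by omega : p + k + 1 ≠ i + 1)]
    rcases lt_trichotomy i p with h2 | rfl | h2
    · rcases (by omega : i + 1 < p ∨ p = i + 1) with h3 | rfl
      · rw [if_neg (by omega), if_neg (by omega), pointTie_add, h.smul_of_lt p k i h3 (by omega)]
      · rw [if_neg (by omega), if_pos rfl, h.smul_pred i k (by omega), ← pointTie_add]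
        congr 1
        omega
    · obtain ⟨l, rfl⟩ : ∃ l, k = l + 1 := ⟨k - 1, by omega⟩
      rw [if_pos rfl, h.smul_left i l (by omega), ← pointTie_add]
      congr 1
      omega
    · rw [if_neg (by omega), if_neg (by omega), pointTie_add,
        h.smul_of_mem p k i h2 h1 (by omega)]
  · rw [if_neg (by omega : p + k + 1 ≠ p + k), if_pos rfl]
    rcases Nat.eq_zero_or_pos k with rfl | hk
    · rw [if_pos (by omega), pointTie_comm]
      exact (h.fix p p hi hi (Or.inl rfl)).trans (pointTie_succ p).symm
    · obtain ⟨l, rfl⟩ : ∃ l, k = l + 1 := ⟨k - 1, by omega⟩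
      rw [if_neg (by omega), if_neg (by omega)]
      exact (h.sq_smul p l hi).trans (pointTie_add p l).symm
  · rcases (by omega : i = p + k + 1 ∨ p + k + 1 < i) with rfl | h2
    · rw [if_neg (by omega), if_neg (by omega), if_pos rfl]
      exact (pointTie_add p (k + 1)).symm
    · rw [if_neg (by omega), if_neg (by omega), if_neg (by omega), if_neg (by omega), pointTie_add,
        h.smul_of_gt p k i h2 hi]

/-- The word defining a tie that starts at p only involves γ_j with j > p, so γ_0 never occurs and z
need not commute with it. This matters for g_1, whose relation with g_2 is the braid relation of
length four. -/
theorem smul_pointTie_of_commute (z : G) {p q : ℕ} (hp : p ≤ m) (hq : q ≤ m)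
    (h : ∀ j, 0 < j → j < m → z * γ j = γ j * z) (h' : ∀ j, j < m → z • ε j = ε j) :
    z • pointTie γ ε p q = pointTie γ ε p q := by
  rw [pointTie]
  split_ifs
  · exact smul_longTie_of_commute _ _ _ (fun j _ _ => h j (by omega) (by omega)) (h' _ (by omega))
  · exact smul_longTie_of_commute _ _ _ (fun j _ _ => h j (by omega) (by omega)) (h' _ (by omega))
  · exact smul_one z

theorem exists_perm_apply_val {k n : ℕ} (f : Fin k → Fin n) (hf : Function.Injective f) :
    ∃ σ : Equiv.Perm (Fin n), ∀ i, (σ (f i)).val = i.val := by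
  have hk : k ≤ n := by simpa using Fintype.card_le_of_injective f hf
  obtain ⟨σ, hσ⟩ := Equiv.Perm.exists_smul_eq_embedding (⟨f, hf⟩ : Fin k ↪ Fin n)
    (Fin.castLEEmb hk)
  exact ⟨σ, fun i => congrArg Fin.val (DFunLike.congr_fun hσ i)⟩

/-- A braid tie family, together with elements `F_0, …, F_m` (ties with an additional point that is
fixed by the group) that are permuted like points. -/
structure IsPointedBraidTie (m : ℕ) (γ : ℕ → G) (ε F : ℕ → X) : Prop extends
    IsBraidTie m γ ε where
  smul_F : ∀ i p, i < m → p ≤ m → γ i • F p = F (natSwap i p)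
  ε_idem : ∀ i, i < m → ε i * ε i = ε i
  F_idem : ∀ p, p ≤ m → F p * F p = F p
  ε_comm : ∀ i j, i < m → j < m → ε i * ε j = ε j * ε i
  ε_F_comm : ∀ i p, i < m → p ≤ m → ε i * F p = F p * ε i
  F_comm : ∀ p q, p ≤ m → q ≤ m → F p * F q = F q * F p
  ε_triangle : 1 < m → ε 0 * ε 1 = ε 0 * γ 1 • ε 0
  F_triangle : 0 < m → F 0 * ε 0 = F 0 * F 1

/-! ### Identities among ties, by moving points to standard position. -/

namespace IsPointedBraidTie

variable {F : ℕ → X} (h : IsPointedBraidTie m γ ε F)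
include h

/-- Each γ_i realizes an adjacent transposition simultaneously on all ties and all F_p, and these
generate the symmetric group. As G acts by injective monoid maps, an identity among ties needs
checking for only one configuration of points in each orbit. -/
theorem exists_smul (σ : Equiv.Perm (Fin (m + 1))) : ∃ z : G, ∀ p q : Fin (m + 1),
    z • pointTie γ ε p q = pointTie γ ε (σ p) (σ q) ∧ z • F p = F (σ p) := by
  have hσ : σ ∈ Submonoid.closure
      (Set.range fun i : Fin m ↦ Equiv.swap i.castSucc i.succ) := by
    rw [Equiv.Perm.mclosure_swap_castSucc_succ]; trivial
  induction hσ using Submonoid.closure_induction with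
  | mem σ hσ =>
    obtain ⟨i, rfl⟩ := hσ
    have key : ∀ p : Fin (m + 1), (Equiv.swap i.castSucc i.succ p).val = natSwap i p := by
      intro p
      rw [natSwap_apply, Equiv.swap_apply_def]
      simp only [Fin.ext_iff]
      split_ifs <;> simp_all
    refine ⟨γ i, fun p q => ⟨?_, ?_⟩⟩
    · rw [h.smul_pointTie i.isLt p.is_le q.is_le, key, key]
    · rw [h.smul_F i p i.isLt p.is_le, key]
  | one => exact ⟨1, fun p q => ⟨one_smul _ _, one_smul _ _⟩⟩
  | mul σ τ _ _ hσ hτ =>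
    obtain ⟨z, hz⟩ := hσ
    obtain ⟨z', hz'⟩ := hτ
    refine ⟨z * z', fun p q => ⟨?_, ?_⟩⟩
    · rw [mul_smul, (hz' p q).1, (hz _ _).1]; rfl
    · rw [mul_smul, (hz' p q).2, (hz _ (τ q)).2]; rfl

theorem exists_smul_of_injective {k : ℕ} (f : Fin k → Fin (m + 1)) (hf : Function.Injective f) :
    ∃ z : G, ∀ i j : Fin k,
      z • pointTie γ ε (f i) (f j) = pointTie γ ε i j ∧ z • F (f i) = F i := by
  obtain ⟨σ, hσ⟩ := exists_perm_apply_val f hf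
  obtain ⟨z, hz⟩ := h.exists_smul σ
  exact ⟨z, fun i j => ⟨by rw [(hz _ _).1, hσ, hσ], by rw [(hz _ (f j)).2, hσ]⟩⟩

theorem exists_smul_pair {p q : Fin (m + 1)} (hpq : p ≠ q) : 0 < m ∧ ∃ z : G,
    z • pointTie γ ε p q = ε 0 ∧ z • F p = F 0 ∧ z • F q = F 1 := by
  have hf : Function.Injective ![p, q] := by
    intro i j hij; fin_cases i <;> fin_cases j <;> simp_all
  have hm : 0 < m := by have := Fintype.card_le_of_injective _ hf; simp at this; omega
  obtain ⟨z, hz⟩ := h.exists_smul_of_injective _ hf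
  exact ⟨hm, z, (hz 0 1).1.trans (pointTie_succ 0), (hz 0 1).2, (hz 1 1).2⟩

theorem exists_smul_triple {p q r : Fin (m + 1)} (hpq : p ≠ q) (hpr : p ≠ r) (hqr : q ≠ r) :
    1 < m ∧ ∃ z : G, z • pointTie γ ε p q = ε 0 ∧ z • pointTie γ ε q r = ε 1 ∧
      z • pointTie γ ε p r = γ 1 • ε 0 := by
  have hf : Function.Injective ![p, q, r] := by
    intro i j hij; fin_cases i <;> fin_cases j <;> simp_all
  have hm : 1 < m := by have := Fintype.card_le_of_injective _ hf; simp at this; omega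
  obtain ⟨z, hz⟩ := h.exists_smul_of_injective _ hf
  exact ⟨hm, z, (hz 0 1).1.trans (pointTie_succ 0), (hz 1 2).1.trans (pointTie_succ 1),
    (hz 0 2).1.trans (pointTie_add 0 1)⟩

theorem exists_smul_quadruple {p q r s : Fin (m + 1)} (hpq : p ≠ q) (hpr : p ≠ r) (hps : p ≠ s)
    (hqr : q ≠ r) (hqs : q ≠ s) (hrs : r ≠ s) :
    2 < m ∧ ∃ z : G, z • pointTie γ ε p q = ε 0 ∧ z • pointTie γ ε r s = ε 2 := by
  have hf : Function.Injective ![p, q, r, s] := by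
    intro i j hij; fin_cases i <;> fin_cases j <;> simp_all
  have hm : 2 < m := by have := Fintype.card_le_of_injective _ hf; simp at this; omega
  obtain ⟨z, hz⟩ := h.exists_smul_of_injective _ hf
  exact ⟨hm, z, (hz 0 1).1.trans (pointTie_succ 0), (hz 2 3).1.trans (pointTie_succ 2)⟩

theorem pointTie_idem (p q : Fin (m + 1)) :
    pointTie γ ε p q * pointTie γ ε p q = pointTie γ ε p q := by
  rcases eq_or_ne p q with rfl | hpq
  · rw [pointTie_self, one_mul]
  obtain ⟨hm, z, hz, -⟩ := h.exists_smul_pair hpq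
  rw [← smul_left_cancel_iff z, smul_mul', hz, h.ε_idem 0 hm]

theorem F_mul_pointTie (p q : Fin (m + 1)) : F p * pointTie γ ε p q = F p * F q := by
  rcases eq_or_ne p q with rfl | hpq
  · rw [pointTie_self, mul_one, h.F_idem p p.is_le]
  obtain ⟨hm, z, hz, hz', hz''⟩ := h.exists_smul_pair hpq
  rw [← smul_left_cancel_iff z, smul_mul', smul_mul', hz, hz', hz'', h.F_triangle hm]

/-- Only p and q are moved to 0 and 1; r goes wherever the permutation sends it, since ε_0 commutes
with every F. -/
theorem pointTie_mul_F (p q r : Fin (m + 1)) : pointTie γ ε p q * F r = F r * pointTie γ ε p q := by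
  rcases eq_or_ne p q with rfl | hpq
  · rw [pointTie_self, mul_one, one_mul]
  have hf : Function.Injective ![p, q] := by
    intro i j hij; fin_cases i <;> fin_cases j <;> simp_all
  have hm : 0 < m := by have := Fintype.card_le_of_injective _ hf; simp at this; omega
  obtain ⟨σ, hσ⟩ := exists_perm_apply_val _ hf
  obtain ⟨z, hz⟩ := h.exists_smul σ
  have h1 : z • pointTie γ ε p q = ε 0 := by
    have hp : (σ p).val = 0 := hσ 0
    have hq : (σ q).val = 1 := hσ 1
    rw [(hz p q).1, hp, hq]
    exact pointTie_succ 0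
  rw [← smul_left_cancel_iff z, smul_mul', smul_mul', h1, (hz r r).2,
    h.ε_F_comm 0 _ hm (σ r).is_le]

theorem pointTie_mul_pointTie_adjacent {p q r : Fin (m + 1)} (hpq : p ≠ q) (hpr : p ≠ r)
    (hqr : q ≠ r) : pointTie γ ε p q * pointTie γ ε q r = pointTie γ ε q r * pointTie γ ε p q := by
  obtain ⟨hm, z, hz, hz', -⟩ := h.exists_smul_triple hpq hpr hqr
  rw [← smul_left_cancel_iff z, smul_mul', smul_mul', hz, hz', h.ε_comm 0 1 (by omega) hm]

/-- Two different nontrivial ties share one point or none, so up to symmetry the commutation of ε_0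
with ε_1 and with ε_2 is enough. -/
theorem pointTie_mul_pointTie_comm (p q r s : Fin (m + 1)) :
    pointTie γ ε p q * pointTie γ ε r s = pointTie γ ε r s * pointTie γ ε p q := by
  rcases eq_or_ne p q with rfl | hpq
  · rw [pointTie_self, mul_one, one_mul]
  rcases eq_or_ne r s with rfl | hrs
  · rw [pointTie_self, mul_one, one_mul]
  have hadj : ∀ t : Fin (m + 1), t ≠ q → t ≠ p →
      pointTie γ ε p q * pointTie γ ε q t = pointTie γ ε q t * pointTie γ ε p q ∧
      pointTie γ ε p q * pointTie γ ε p t = pointTie γ ε p t * pointTie γ ε p q := by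
    intro t htq htp
    refine ⟨h.pointTie_mul_pointTie_adjacent hpq htp.symm htq.symm, ?_⟩
    rw [pointTie_comm p q]
    exact h.pointTie_mul_pointTie_adjacent hpq.symm htq.symm htp.symm
  by_cases hqr : q = r
  · subst hqr
    by_cases hps : p = s
    · subst hps; rw [pointTie_comm]
    · exact (hadj s hrs.symm (Ne.symm hps)).1
  by_cases hqs : q = s
  · subst hqs
    by_cases hpr : p = r
    · subst hpr; rfl
    · rw [pointTie_comm r]; exact (hadj r hrs (Ne.symm hpr)).1
  by_cases hpr : p = r
  · subst hpr; exact (hadj s (Ne.symm hqs) hrs.symm).2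
  by_cases hps : p = s
  · subst hps; rw [pointTie_comm r]; exact (hadj r (Ne.symm hqr) hrs).2
  obtain ⟨hm, z, hz, hz'⟩ := h.exists_smul_quadruple hpq hpr hps hqr hqs hrs
  rw [← smul_left_cancel_iff z, smul_mul', smul_mul', hz, hz', h.ε_comm 0 2 (by omega) hm]

theorem pointTie_triangle (p q r : Fin (m + 1)) :
    pointTie γ ε p q * pointTie γ ε q r = pointTie γ ε p q * pointTie γ ε p r := by
  rcases eq_or_ne p q with rfl | hpq
  · rfl
  rcases eq_or_ne p r with rfl | hpr
  · rw [pointTie_comm q, h.pointTie_idem, pointTie_self, mul_one]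
  rcases eq_or_ne q r with rfl | hqr
  · rw [h.pointTie_idem, pointTie_self, mul_one]
  obtain ⟨hm, z, hz, hz', hz''⟩ := h.exists_smul_triple hpq hpr hqr
  rw [← smul_left_cancel_iff z, smul_mul', smul_mul', hz, hz', hz'', h.ε_triangle hm]

end IsPointedBraidTie

/-- The tie between two points of `{0, …, m + 1}`, where `0` is the additional point. -/
def fullTie (γ : ℕ → G) (ε F : ℕ → X) : ℕ → ℕ → X
  | 0, 0 => 1
  | 0, q + 1 => F q
  | p + 1, 0 => F p
  | p + 1, q + 1 => pointTie γ ε p q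

theorem fullTie_self (F : ℕ → X) (a : ℕ) : fullTie γ ε F a a = 1 := by
  cases a with
  | zero => rfl
  | succ p => exact pointTie_self p

theorem fullTie_comm (F : ℕ → X) (a b : ℕ) : fullTie γ ε F a b = fullTie γ ε F b a := by
  cases a <;> cases b <;> first | rfl | exact pointTie_comm _ _

namespace IsPointedBraidTie

variable {F : ℕ → X} (h : IsPointedBraidTie m γ ε F)
include h

theorem fullTie_idem (a b : ℕ) (ha : a ≤ m + 1) (hb : b ≤ m + 1) :
    fullTie γ ε F a b * fullTie γ ε F a b = fullTie γ ε F a b := by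
  rcases a with _ | p <;> rcases b with _ | q
  · exact one_mul 1
  · exact h.F_idem q (by omega)
  · exact h.F_idem p (by omega)
  · exact h.pointTie_idem ⟨p, by omega⟩ ⟨q, by omega⟩

theorem fullTie_mul_comm (a b c d : ℕ) (ha : a ≤ m + 1) (hb : b ≤ m + 1) (hc : c ≤ m + 1)
    (hd : d ≤ m + 1) :
    fullTie γ ε F a b * fullTie γ ε F c d = fullTie γ ε F c d * fullTie γ ε F a b := by
  have h1 : ∀ p q r, p ≤ m → q ≤ m → r ≤ m →
      pointTie γ ε p q * F r = F r * pointTie γ ε p q := fun p q r hp hq hr =>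
    h.pointTie_mul_F ⟨p, by omega⟩ ⟨q, by omega⟩ ⟨r, by omega⟩
  rcases a with _ | p <;> rcases b with _ | q <;> rcases c with _ | r <;> rcases d with _ | s <;>
    simp only [fullTie, one_mul, mul_one]
  any_goals exact h.F_comm _ _ (by omega) (by omega)
  any_goals exact h1 _ _ _ (by omega) (by omega) (by omega)
  any_goals exact (h1 _ _ _ (by omega) (by omega) (by omega)).symm
  exact h.pointTie_mul_pointTie_comm ⟨p, by omega⟩ ⟨q, by omega⟩ ⟨r, by omega⟩ ⟨s, by omega⟩

theorem fullTie_triangle (a b c : ℕ) (ha : a ≤ m + 1) (hb : b ≤ m + 1) (hc : c ≤ m + 1) :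
    fullTie γ ε F a b * fullTie γ ε F b c = fullTie γ ε F a b * fullTie γ ε F a c := by
  rcases a with _ | p <;> rcases b with _ | q <;> rcases c with _ | r <;>
    simp only [fullTie, one_mul, mul_one]
  · exact h.F_idem q (by omega)
  · exact h.F_mul_pointTie ⟨q, by omega⟩ ⟨r, by omega⟩
  · exact (h.F_idem p (by omega)).symm
  · exact (h.F_mul_pointTie ⟨p, by omega⟩ ⟨r, by omega⟩).symm
  -- Here the third point is the additional one, and both sides reduce to the product of F_p and
  -- F_q.
  · rw [h.pointTie_mul_F ⟨p, by omega⟩ ⟨q, by omega⟩ ⟨q, by omega⟩,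
      h.pointTie_mul_F ⟨p, by omega⟩ ⟨q, by omega⟩ ⟨p, by omega⟩,
      h.F_mul_pointTie ⟨p, by omega⟩ ⟨q, by omega⟩, pointTie_comm,
      h.F_mul_pointTie ⟨q, by omega⟩ ⟨p, by omega⟩]
    exact h.F_comm _ _ (by omega) (by omega)
  · exact h.pointTie_triangle ⟨p, by omega⟩ ⟨q, by omega⟩ ⟨r, by omega⟩

theorem smul_fullTie (i a b : ℕ) (hi : i < m) (ha : a ≤ m + 1) (hb : b ≤ m + 1) :
    γ i • fullTie γ ε F a b = fullTie γ ε F (natSwap (i + 1) a) (natSwap (i + 1) b) := by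
  have h0 : natSwap (i + 1) 0 = 0 := by rw [natSwap_apply, if_neg (by omega), if_neg (by omega)]
  have hs : ∀ p, natSwap (i + 1) (p + 1) = natSwap i p + 1 := by
    intro p
    rw [natSwap_apply, natSwap_apply]
    split_ifs <;> omega
  rcases a with _ | p <;> rcases b with _ | q <;> simp only [h0, hs, fullTie]
  · exact smul_one _
  · exact h.smul_F i q hi (by omega)
  · exact h.smul_F i p hi (by omega)
  · exact h.smul_pointTie hi (by omega) (by omega)

omit h in
theorem smul_fullTie_of_commute (z : G) {a b : ℕ} (ha : a ≤ m + 1) (hb : b ≤ m + 1)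
    (h : ∀ j, 0 < j → j < m → z * γ j = γ j * z) (h' : ∀ j, j < m → z • ε j = ε j)
    (h'' : ∀ p, p ≤ m → z • F p = F p) : z • fullTie γ ε F a b = fullTie γ ε F a b := by
  rcases a with _ | p <;> rcases b with _ | q
  · exact smul_one _
  · exact h'' q (by omega)
  · exact h'' p (by omega)
  · exact smul_pointTie_of_commute z (by omega) (by omega) h h'

end IsPointedBraidTie

end Points

end ActionTies

/-! ## From the Marin ring to the braids and ties algebra -/

namespace FloresAlgebra

variable {n : ℕ} {R : Type y} [CommRing R] (u : Fin n → Rˣ)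

theorem mk_eq_of_rel {a b : FreeAlgebra R (Gen n)} (h : FloresRel u a b) : mk u a = mk u b :=
  RingQuot.mkAlgHom_rel R h

theorem g_mul_g_comm {i j : Fin n} (h : 1 < gap i j) : g u i * g u j = g u j * g u i := by
  simpa only [g, e, f, map_mul] using mk_eq_of_rel u (.gg i j h)

theorem g_braid_four {i j : Fin n} (hi : i.val = 0) (hj : j.val = 1) :
    g u i * g u j * g u i * g u j = g u j * g u i * g u j * g u i := by
  simpa only [g, e, f, map_mul] using mk_eq_of_rel u (.gggg i j hi hj)

theorem g_braid_three {i j : Fin n} (h : gap i j = 1) (h' : ¬ IsFirstPair i j) :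
    g u i * g u j * g u i = g u j * g u i * g u j := by
  simpa only [g, e, f, map_mul] using mk_eq_of_rel u (.ggg i j h h')

theorem g_mul_g (i : Fin n) :
    g u i * g u i = 1 + ((u i : R) - 1) • (e u i * (1 - g u i)) := by
  simpa only [g, e, f, map_mul, map_add, map_one, map_smul, map_sub] using mk_eq_of_rel u (.quadratic i)

theorem g_mul_e {i j : Fin n} (h : gap i j ≠ 1 ∨ (i.val = 0 ∧ j.val = 1)) :
    g u i * e u j = e u j * g u i := by
  simpa only [g, e, f, map_mul] using mk_eq_of_rel u (.ge i j h)

theorem gap_self (i : Fin n) : gap i i = 0 := by simp [gap]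

theorem g_mul_e_self (i : Fin n) : g u i * e u i = e u i * g u i :=
  g_mul_e u (Or.inl (by simp [gap_self]))

theorem g_mul_g_mul_e {i j : Fin n} (h : gap i j = 1) (h' : ¬ IsFirstPair i j) :
    g u j * g u i * e u j = e u i * (g u j * g u i) := by
  simpa only [g, e, f, map_mul, mul_assoc] using mk_eq_of_rel u (.gge i j h h')

theorem e_mul_e_comm (i j : Fin n) : e u i * e u j = e u j * e u i := by
  simpa only [g, e, f, map_mul] using mk_eq_of_rel u (.ee i j)

theorem e_mul_e_self (i : Fin n) : e u i * e u i = e u i := by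
  simpa only [g, e, f, map_mul] using mk_eq_of_rel u (.e_sq i)

theorem e_mul_e_mul_g {i j : Fin n} (h : gap i j = 1) (h' : ¬ IsFirstPair i j) :
    e u j * e u i * g u j = e u i * g u j * e u i := by
  simpa only [g, e, f, map_mul] using mk_eq_of_rel u (.eeg_ege i j h h')

theorem e_mul_g_mul_e {i j : Fin n} (h : gap i j = 1) (h' : ¬ IsFirstPair i j) :
    e u i * g u j * e u i = g u j * e u i * e u j := by
  simpa only [g, e, f, map_mul] using mk_eq_of_rel u (.ege_gee i j h h')

theorem f_eq_e {i : Fin n} (hi : i.val = 0) : f u i = e u i := mk_eq_of_rel u (.f_first i hi)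

theorem g_mul_f {i j : Fin n} (h : i.val = 0 ∨ (1 ≤ i.val ∧ j.val + 1 ≠ i.val ∧ j ≠ i)) :
    g u i * f u j = f u j * g u i := by
  simpa only [g, e, f, map_mul] using mk_eq_of_rel u (.gf i j h)

theorem e_mul_f_comm (i j : Fin n) : e u i * f u j = f u j * e u i := by
  simpa only [g, e, f, map_mul] using mk_eq_of_rel u (.ef i j)

theorem f_mul_f_comm (i j : Fin n) : f u i * f u j = f u j * f u i := by
  simpa only [g, e, f, map_mul] using mk_eq_of_rel u (.ff i j)

theorem g_mul_f_pred {i j : Fin n} (h : j.val + 1 = i.val) : g u i * f u j = f u i * g u i := by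
  simpa only [g, e, f, map_mul] using mk_eq_of_rel u (.gf_pred i j h)

theorem g_mul_f_self {i j : Fin n} (h : j.val + 1 = i.val) : g u i * f u i = f u j * g u i := by
  simpa only [g, e, f, map_mul] using mk_eq_of_rel u (.gf_self i j h)

theorem e_mul_f_eq {i j : Fin n} (h : j.val = i.val + 1) : e u j * f u i = f u j * f u i := by
  simpa only [g, e, f, map_mul] using mk_eq_of_rel u (.ef_ff i j h)

theorem hat_mul_hat_inv (i : Fin n) {r r' : R} (h : r * r' = 1) :
    (1 + (r - 1) • e u i) * (1 + (r' - 1) • e u i) = 1 := by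
  simp only [add_mul, mul_add, one_mul, mul_one, smul_mul_assoc, mul_smul_comm, e_mul_e_self]
  have h3 : (r - 1) + ((r' - 1) + (r' - 1) * (r - 1)) = 0 := by linear_combination h
  rw [add_assoc, smul_add, smul_smul, ← add_smul, ← add_smul]
  rw [h3, zero_smul, add_zero]

/-- The quadratic relation, rearranged. The right side is a unit because e_i is idempotent, and this
makes g_i invertible, so that conjugation by g_i makes sense. -/
theorem g_mul_add (i : Fin n) :
    g u i * (g u i + ((u i : R) - 1) • e u i) = 1 + ((u i : R) - 1) • e u i := by
  rw [mul_add, g_mul_g, mul_smul_comm, g_mul_e_self, mul_sub, mul_one, smul_sub]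
  abel

theorem add_mul_g (i : Fin n) :
    (g u i + ((u i : R) - 1) • e u i) * g u i = 1 + ((u i : R) - 1) • e u i := by
  rw [← g_mul_add, add_mul, mul_add, smul_mul_assoc, mul_smul_comm, g_mul_e_self]

/-- The generator `g_i`, as a unit. -/
def gUnit (i : Fin n) : (FloresAlgebra u)ˣ where
  val := g u i
  inv := (g u i + ((u i : R) - 1) • e u i) * (1 + (((u i)⁻¹ : Rˣ) - 1 : R) • e u i)
  val_inv := by
    rw [← mul_assoc, g_mul_add]
    exact hat_mul_hat_inv u i (by simp)
  inv_val := by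
    have h : (1 + (((u i)⁻¹ : Rˣ) - 1 : R) • e u i) * g u i =
        g u i * (1 + (((u i)⁻¹ : Rˣ) - 1 : R) • e u i) := by
      rw [add_mul, mul_add, one_mul, mul_one, smul_mul_assoc, mul_smul_comm, g_mul_e_self]
    rw [mul_assoc, h, ← mul_assoc, add_mul_g]
    exact hat_mul_hat_inv u i (by simp)

theorem gUnit_braid (i j : Fin n) :
    ((CoxeterSystem.alternatingWord i j (typeB n i j)).map (gUnit u)).prod =
      ((CoxeterSystem.alternatingWord j i (typeB n i j)).map (gUnit u)).prod := by
  rcases eq_or_ne i j with rfl | hij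
  · rfl
  have hij' : i.val ≠ j.val := fun h => hij (Fin.ext h)
  by_cases hfst : IsFirstPair i j
  · have h4 : typeB n i j = 4 := by
      rw [typeB_apply, if_neg hij, if_pos (by rwa [IsFirstPair] at hfst)]
    rw [h4, prod_alternatingWord_four, prod_alternatingWord_four]
    apply Units.ext
    rcases hfst with h | h
    · exact g_braid_four u h.1 h.2
    · exact (g_braid_four u h.2 h.1).symm
  by_cases hgap : gap i j = 1
  · rw [typeB_eq_three hgap hfst, prod_alternatingWord_three, prod_alternatingWord_three]
    exact Units.ext (g_braid_three u hgap hfst).symm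
  · have h2 : 1 < gap i j := by rw [gap] at *; omega
    rw [typeB_eq_two h2, prod_alternatingWord_two, prod_alternatingWord_two]
    exact Units.ext (g_mul_g_comm u h2)

theorem gap_succ {i j : Fin n} (h : j.val = i.val + 1) : gap i j = 1 := by rw [gap]; omega

theorem gap_comm (i j : Fin n) : gap i j = gap j i := by rw [gap, gap]; omega

theorem not_isFirstPair {i j : Fin n} (hi : i.val ≠ 0) (hj : j.val ≠ 0) : ¬ IsFirstPair i j := by
  rw [IsFirstPair]; omega

/-- By the quadratic relation it suffices that e_i commutes with e_j and with e_j g_j. The latter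
follows from e_j e_i g_j = e_i g_j e_i = g_j e_i e_j. -/
theorem g_sq_mul_e {i j : Fin n} (h : gap i j = 1) (h' : ¬ IsFirstPair i j) :
    g u j * g u j * e u i = e u i * (g u j * g u j) := by
  have key : e u j * g u j * e u i = e u i * (e u j * g u j) := by
    rw [← g_mul_e_self, mul_assoc, e_mul_e_comm, ← mul_assoc, ← e_mul_g_mul_e u h h',
      ← e_mul_e_mul_g u h h', g_mul_e_self, ← mul_assoc, e_mul_e_comm]
  rw [g_mul_g, add_mul, mul_add, one_mul, mul_one, smul_mul_assoc, mul_smul_comm, mul_sub, mul_one,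
    sub_mul, mul_sub, key, e_mul_e_comm]

/-- This is not among the defining relations: f_1 = e_1 is idempotent, and each f_i is the conjugate
of f_{i-1} by g_i. -/
theorem f_mul_f_self (i : Fin n) : f u i * f u i = f u i := by
  obtain ⟨k, hk⟩ := i
  induction k with
  | zero => rw [f_eq_e u rfl, e_mul_e_self]
  | succ k ih =>
    have h1 := g_mul_f_pred u (i := ⟨k + 1, hk⟩) (j := ⟨k, Nat.lt_of_succ_lt hk⟩) rfl
    rw [← (gUnit u ⟨k + 1, hk⟩).mul_left_inj]
    change _ * _ * g u _ = _ * g u _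
    rw [mul_assoc, ← h1, ← mul_assoc, ← h1, mul_assoc, ih]

/-- The conjugation by `g_{i+1}`. -/
def conjGen (i : ℕ) : ConjAct (FloresAlgebra u)ˣ :=
  if h : i + 1 < n then ConjAct.toConjAct (gUnit u ⟨i + 1, h⟩) else 1

/-- The tie `e_{i+1}`. -/
def eShift (i : ℕ) : FloresAlgebra u := if h : i + 1 < n then e u ⟨i + 1, h⟩ else 1

/-- The tie `f_i`, indexed by the natural numbers. -/
def fNat (i : ℕ) : FloresAlgebra u := if h : i < n then f u ⟨i, h⟩ else 1

theorem conjAct_smul_eq_iff {H : Type*} [Monoid H] (z : Hˣ) (a b : H) :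
    ConjAct.toConjAct z • a = b ↔ z * a = b * z := by
  rw [ConjAct.units_smul_def, ConjAct.ofConjAct_toConjAct, Units.mul_inv_eq_iff_eq_mul]

/-- In the labels 1, …, n, γ_i is conjugation by g_{i+2}, ε_i is e_{i+2} and F_p is f_{p+1}. Thus
the abstract point p is the point p + 1 of {0, …, n}, and the additional point is 0. The generator
g_1 is left out because it moves no point. -/
theorem isPointedBraidTie :
    IsPointedBraidTie (n - 1) (conjGen u) (eShift u) (fNat u) := by
  have hγ : ∀ {i} (h : i + 1 < n), conjGen u i = ConjAct.toConjAct (gUnit u ⟨i + 1, h⟩) :=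
    fun h => dif_pos h
  have hε : ∀ {i} (h : i + 1 < n), eShift u i = e u ⟨i + 1, h⟩ := fun h => dif_pos h
  have hF : ∀ {i} (h : i < n), fNat u i = f u ⟨i, h⟩ := fun h => dif_pos h
  have hF' : ∀ p q, p ≤ n - 1 → q ≤ n - 1 → fNat u p * fNat u q = fNat u q * fNat u p := by
    intro p q hp hq
    -- For n = 0 the truncated difference n - 1 is 0, so the index 0 is still allowed and `fNat`
    -- takes its default value 1 there.
    rcases Nat.eq_zero_or_pos n with h0 | h0
    · obtain rfl : p = q := by omega
      rfl
    · rw [hF (by omega : p < n), hF (by omega : q < n), f_mul_f_comm]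
  refine ⟨⟨?_, ?_, ?_, ?_, ?_, ?_⟩, ?_, ?_, ?_, ?_, ?_, hF', ?_, ?_⟩
  · intro i j hij hj
    rw [hγ (by omega), hγ (by omega), ← ConjAct.toConjAct_mul, ← ConjAct.toConjAct_mul]
    exact congrArg _ (Units.ext (g_mul_g_comm u (by simp only [gap]; omega)))
  · intro i hi
    rw [hγ (by omega), hγ (by omega)]
    simp only [← ConjAct.toConjAct_mul]
    exact congrArg _ (Units.ext (g_braid_three u (gap_succ rfl) (not_isFirstPair (by simp) (by simp))))
  · intro i j hi hj hij
    rw [hγ (by omega), hε (by omega), conjAct_smul_eq_iff]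
    exact g_mul_e u (Or.inl (by simp only [gap]; omega))
  · intro i hi
    rw [hγ (by omega), hγ (by omega), hε (by omega), hε (by omega), smul_smul,
      ← ConjAct.toConjAct_mul, conjAct_smul_eq_iff]
    exact g_mul_g_mul_e u (gap_comm _ _ |>.trans (gap_succ rfl))
      (not_isFirstPair (by simp) (by simp))
  · intro i hi
    rw [hγ (by omega), hε (by omega), smul_smul, ← ConjAct.toConjAct_mul, conjAct_smul_eq_iff]
    exact g_sq_mul_e u (gap_comm _ _ |>.trans (gap_succ rfl)) (not_isFirstPair (by simp) (by simp))
  · intro i hi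
    rw [hγ (by omega), hε (by omega), smul_smul, ← ConjAct.toConjAct_mul, conjAct_smul_eq_iff]
    exact g_sq_mul_e u (gap_succ rfl) (not_isFirstPair (by simp) (by simp))
  · intro i p hi hp
    rw [hγ (by omega), hF (by omega : p < n), natSwap_apply, conjAct_smul_eq_iff]
    split_ifs with h1 h2
    · subst h1
      rw [hF (by omega)]
      exact g_mul_f_pred u rfl
    · subst h2
      rw [hF (by omega)]
      exact g_mul_f_self u rfl
    · rw [hF (by omega)]
      exact g_mul_f u (Or.inr ⟨by simp, by simpa using h1, by simpa [Fin.ext_iff] using h2⟩)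
  · intro i hi
    rw [hε (by omega), e_mul_e_self]
  · intro p hp
    rcases Nat.eq_zero_or_pos n with h0 | h0
    · rw [fNat, dif_neg (by omega), one_mul]
    · rw [hF (by omega), f_mul_f_self]
  · intro i j hi hj
    rw [hε (by omega), hε (by omega), e_mul_e_comm]
  · intro i p hi hp
    rw [hε (by omega), hF (by omega), e_mul_f_comm]
  · intro hn
    rw [hε (by omega), hε (by omega), hγ (by omega), ConjAct.units_smul_def,
      ConjAct.ofConjAct_toConjAct, ← mul_assoc, Units.eq_mul_inv_iff_mul_eq, ← mul_assoc,
      e_mul_e_comm]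
    exact e_mul_e_mul_g u (gap_succ rfl) (not_isFirstPair (by simp) (by simp))
  · intro hn
    rw [hε (by omega), hF (by omega : 0 < n), hF (by omega), f_mul_f_comm, ← e_mul_f_comm]
    exact e_mul_f_eq u rfl

/-- The tie of the braids and ties algebra that joins two points. -/
def tie (a b : Fin (n + 1)) : FloresAlgebra u := fullTie (conjGen u) (eShift u) (fNat u) a b

/-- The first edge {0,1} contains the additional point, so there the tie is f_1, which equals e_1.
All other edges are ties of consecutive ordinary points. -/
theorem tie_castSucc_succ (i : Fin n) : tie u i.castSucc i.succ = e u i := by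
  obtain ⟨_ | k, hk⟩ := i
  · exact (dif_pos hk).trans (f_eq_e u rfl)
  · exact (pointTie_succ k).trans (dif_pos hk)

theorem tie_zero_succ (i : Fin n) : tie u 0 i.succ = f u i := dif_pos i.isLt

theorem g_mul_tie (i : Fin n) (a b : Fin (n + 1)) :
    g u i * tie u a b = tie u (bSwap i a) (bSwap i b) * g u i := by
  have h := isPointedBraidTie u
  have ha := a.isLt
  have hb := b.isLt
  refine (conjAct_smul_eq_iff (gUnit u i) _ _).1 ?_
  obtain ⟨_ | k, hk⟩ := i
  -- Conjugation by g_1 fixes all e's and f's and commutes with conjugation by g_3, …, g_n. The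
  -- generator g_2 is γ_0, which is not required.
  · rw [bSwap_of_val_eq_zero rfl, bSwap_of_val_eq_zero rfl]
    refine IsPointedBraidTie.smul_fullTie_of_commute (m := n - 1) _ (by omega) (by omega)
      (fun j h0 hj => ?_) (fun j hj => ?_) fun p hp => ?_
    · rw [conjGen, dif_pos (by omega), ← ConjAct.toConjAct_mul, ← ConjAct.toConjAct_mul]
      exact congrArg _ (Units.ext (g_mul_g_comm u (by simp only [gap]; omega)))
    · rw [eShift, dif_pos (by omega), conjAct_smul_eq_iff]
      rcases Nat.eq_zero_or_pos j with rfl | h0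
      · exact g_mul_e u (Or.inr ⟨rfl, rfl⟩)
      · exact g_mul_e u (Or.inl (by simp only [gap]; omega))
    · rw [fNat, dif_pos (by omega), conjAct_smul_eq_iff]
      exact g_mul_f u (Or.inl rfl)
  · have h1 := h.smul_fullTie k a b (by omega) (by omega) (by omega)
    have h2 : ∀ c : Fin (n + 1), natSwap (k + 1) c = (bSwap ⟨k + 1, hk⟩ c : Fin (n + 1)) := by
      intro c
      rw [natSwap_apply, bSwap, if_neg (Nat.succ_ne_zero k), adjSwap, Equiv.swap_apply_def]
      simp only [Fin.ext_iff]
      split_ifs <;> simp_all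
    rw [h2, h2, conjGen, dif_pos hk] at h1
    exact h1

end FloresAlgebra

section TieHom

variable {n : ℕ} {U : Type w} [Group U] (ct : CoxeterSystem (CoxeterMatrix.A n) U)

/-- The target is not commutative, so the extension property is applied inside the submonoid
generated by the D(a,b), which is. -/
theorem exists_hom_of_ties {X : Type*} [Monoid X] (D : Fin (n + 1) → Fin (n + 1) → X)
    (hcomm : ∀ a b c d, D a b * D c d = D c d * D a b) (hD : ∀ a, D a a = 1)
    (hsymm : ∀ a b, D a b = D b a) (hidem : ∀ a b, D a b * D a b = D a b)
    (htrans : ∀ a b c, D a b * D b c = D a b * D a c) :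
    ∃ Λ : RootSubsystem ct →* X, ∀ a b, Λ (pairSub ct a b) = D a b := by
  let S := Submonoid.closure (Set.range fun p : Fin (n + 1) × Fin (n + 1) => D p.1 p.2)
  have hS : IsMulCommutative S := Submonoid.isMulCommutative_closure X (by
    rintro _ ⟨p, rfl⟩ _ ⟨q, rfl⟩
    exact hcomm _ _ _ _)
  let : CommMonoid S := { S.toMonoid with mul_comm := hS.is_comm.comm }
  let D' : Fin (n + 1) → Fin (n + 1) → S := fun a b =>
    ⟨D a b, Submonoid.subset_closure ⟨(a, b), rfl⟩⟩
  exact ⟨S.subtype.comp (relProdHom (D := D') ct (fun a => Subtype.ext (hD a))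
      (fun a b => Subtype.ext (hsymm a b)) (fun a b => Subtype.ext (hidem a b))
      fun a b c => Subtype.ext (htrans a b c)), fun a b =>
    congrArg Subtype.val (relProdHom_pairSub (D := D') _ _ _ _ a b)⟩

theorem FloresAlgebra.exists_tieHom {R : Type y} [CommRing R] (u : Fin n → Rˣ) :
    ∃ Λ : RootSubsystem ct →* FloresAlgebra u, ∀ a b, Λ (pairSub ct a b) = tie u a b := by
  have h := isPointedBraidTie u
  have ha : ∀ a : Fin (n + 1), a.val ≤ n - 1 + 1 := fun a => by have := a.isLt; omega
  exact exists_hom_of_ties ct (tie u) (fun a b c d => h.fullTie_mul_comm _ _ _ _ (ha a) (ha b)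
    (ha c) (ha d)) (fun a => fullTie_self _ _) (fun a b => fullTie_comm _ _ _)
    (fun a b => h.fullTie_idem _ _ (ha a) (ha b)) fun a b c =>
      h.fullTie_triangle _ _ _ (ha a) (ha b) (ha c)

end TieHom

/-! ## The isomorphism -/

/-- Compatibility with the action propagates from the generators to the Artin group; values in the
units of H are what allows the step to inverse generators. -/
theorem MarinDatum.comm_of_gen {B : Type u} {M : CoxeterMatrix B} {W : Type v} [Group W]
    {k : Type w} {cs : CoxeterSystem M W} {A : Type x} [CommRing k] [CommRing A] [Algebra k A]
    (D : MarinDatum k cs A) {H : Type y} [Ring H] [Algebra k H] (f : A →ₐ[k] H)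
    (g : ArtinGroup M →* Hˣ)
    (h : ∀ s c, (g (ArtinGroup.gen M s) : H) * f c =
      f (D.ρ (cs.simple s) c) * g (ArtinGroup.gen M s)) (c : A) (z : ArtinGroup M) :
    f (D.ρ (ArtinGroup.proj cs z) c) * g z = g z * f c := by
  induction z using ArtinGroup.induction with
  | one => simp
  | mul_gen s z ih =>
    rw [map_mul, map_mul, map_mul, ArtinGroup.proj_gen, Units.val_mul, AlgEquiv.mul_apply,
      ← mul_assoc, ← h, mul_assoc, ih, mul_assoc]
  | mul_gen_inv s z ih =>
    have h1 := h s (D.ρ (cs.simple s)⁻¹ (D.ρ (ArtinGroup.proj cs z) c))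
    rw [← AlgEquiv.mul_apply (D.ρ (cs.simple s)), ← map_mul, mul_inv_cancel, map_one,
      AlgEquiv.one_apply] at h1
    rw [map_mul, map_mul, map_mul, map_inv, map_inv g, ArtinGroup.proj_gen, Units.val_mul,
      AlgEquiv.mul_apply, mul_assoc ((g _)⁻¹ : Hˣ).val, ← ih, Units.eq_inv_mul_iff_mul_eq,
      ← mul_assoc, h1, mul_assoc, Units.mul_inv_cancel_left]

namespace IsBtoA

variable {n : ℕ} {W : Type v} [Group W] {U : Type w} [Group U]
variable {cs : CoxeterSystem (typeB n) W} {ct : CoxeterSystem (CoxeterMatrix.A n) U}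
variable {J : JuyumayaMap cs ct} (hJ : IsBtoA J)
variable {R : Type y} [CommRing R] (u : Fin n → Rˣ)
  (hu : ∀ (g : W) (s t : Fin n), g * cs.simple s * g⁻¹ = cs.simple t → u s = u t)

include hJ

theorem exists_marinRing_to_floresAlgebra :
    ∃ Θ : (J.marinDatum u hu).MarinRing →ₐ[R] FloresAlgebra u, ∀ i : Fin n,
      Θ ((J.marinDatum u hu).g i) = FloresAlgebra.g u i ∧
      Θ (J.tieImage u hu (J.tie i)) = FloresAlgebra.e u i ∧
      Θ (J.tieImage u hu (fTie J i)) = FloresAlgebra.f u i := by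
  obtain ⟨Λ, hΛ⟩ := FloresAlgebra.exists_tieHom ct u
  let f : J.TieAlgebra R →ₐ[R] FloresAlgebra u :=
    MonoidAlgebra.lift R (FloresAlgebra u) J.tieMonoid (Λ.comp J.tieMonoid.subtype)
  have hf : ∀ Ψ : J.tieMonoid, f (MonoidAlgebra.of R J.tieMonoid Ψ) = Λ Ψ := fun Ψ =>
    MonoidAlgebra.lift_of _ _
  let z : ArtinGroup (typeB n) →* (FloresAlgebra u)ˣ :=
    ArtinGroup.lift (FloresAlgebra.gUnit u) (FloresAlgebra.gUnit_braid u)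
  have hz : ∀ i, (z (ArtinGroup.gen (typeB n) i) : FloresAlgebra u) = FloresAlgebra.g u i :=
    fun i => congrArg Units.val (ArtinGroup.lift_gen _ _ i)
  -- A generator w.e_s of the monoid is the tie of some pair of points, usually not adjacent, which
  -- is why conjugation by g_i had to be known on all ties. Products follow formally.
  have hΛg : ∀ (i : Fin n) (Ψ : RootSubsystem ct), Ψ ∈ J.tieMonoid →
      FloresAlgebra.g u i * Λ Ψ = Λ (J.φ (cs.simple i) • Ψ) * FloresAlgebra.g u i := by
    intro i Ψ hΨ
    induction hΨ using Submonoid.closure_induction with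
    | mem Ψ hΨ =>
      obtain ⟨w, s, rfl⟩ := hΨ
      rw [hJ.e_eq_pairSub, smul_pairSub, hJ.φ_smul_pairSub, hΛ, hΛ, FloresAlgebra.g_mul_tie]
    | one => rw [smul_one, map_one, mul_one, one_mul]
    | mul Ψ Ψ' _ _ h h' =>
      rw [smul_mul', map_mul, map_mul, ← mul_assoc, h, mul_assoc, h', mul_assoc]
  have hcomm : ∀ (i : Fin n) (c : J.TieAlgebra R),
      (z (ArtinGroup.gen (typeB n) i) : FloresAlgebra u) * f c =
        f ((J.marinDatum u hu).ρ (cs.simple i) c) * z (ArtinGroup.gen (typeB n) i) := by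
    intro i c
    rw [hz]
    induction c using MonoidAlgebra.induction_on with
    | of Ψ => rw [J.marinDatum_ρ_of, hf, hf, hΛg i Ψ.1 Ψ.2]; rfl
    | add c c' h h' => rw [map_add, map_add, map_add, mul_add, add_mul, h, h']
    | smul r c h => rw [map_smul, map_smul, map_smul, mul_smul_comm, smul_mul_assoc, h]
  have ha : ∀ i, f ((J.marinDatum u hu).a i) = 1 + ((u i : R) - 1) • FloresAlgebra.e u i := by
    intro i
    change f (J.hat i (u i)) = _
    rw [JuyumayaMap.hat, map_add, map_one, map_smul, hf, hJ.coe_tie, hΛ,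
      FloresAlgebra.tie_castSucc_succ]
  have hquad : ∀ i, ((Units.coeHom (FloresAlgebra u)).comp z) (ArtinGroup.gen (typeB n) i) *
      ((Units.coeHom (FloresAlgebra u)).comp z) (ArtinGroup.gen (typeB n) i) =
      f ((J.marinDatum u hu).a i) + f (1 - (J.marinDatum u hu).a i) *
        ((Units.coeHom (FloresAlgebra u)).comp z) (ArtinGroup.gen (typeB n) i) := by
    intro i
    rw [map_sub, map_one, ha]
    change (z _ : FloresAlgebra u) * (z _ : FloresAlgebra u) = _ + _ * (z _ : FloresAlgebra u)
    rw [hz, FloresAlgebra.g_mul_g, mul_sub, mul_one, smul_sub, sub_add_cancel_left, neg_mul,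
      smul_mul_assoc]
    abel
  let Θ := (J.marinDatum u hu).lift f ((Units.coeHom (FloresAlgebra u)).comp z)
    ((J.marinDatum u hu).comm_of_gen f z hcomm) hquad
  refine ⟨Θ, fun i => ⟨?_, ?_, ?_⟩⟩
  · exact (MarinDatum.lift_g _ _ _ _ _ i).trans (hz i)
  · refine (MarinDatum.lift_coeff _ _ _ _ _ _).trans ?_
    rw [hf, hJ.coe_tie, hΛ, FloresAlgebra.tie_castSucc_succ]
  · refine (MarinDatum.lift_coeff _ _ _ _ _ _).trans ?_
    rw [hf, hJ.coe_fTie, hΛ, FloresAlgebra.tie_zero_succ]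

/-- The homomorphism from the braids and ties algebra to the Marin ring. -/
def floresToMarin : FloresAlgebra u →ₐ[R] (J.marinDatum u hu).MarinRing :=
  RingQuot.liftAlgHom R ⟨FreeAlgebra.lift R fun
      | Gen.g i => (J.marinDatum u hu).g i
      | Gen.e i => J.tieImage u hu (J.tie i)
      | Gen.f i => J.tieImage u hu (fTie J i), hJ.respects_floresRel u hu⟩

theorem floresToMarin_mk (X : Gen n) : hJ.floresToMarin u hu
    (FloresAlgebra.mk u (FreeAlgebra.ι R X)) = match X with
      | Gen.g i => (J.marinDatum u hu).g i
      | Gen.e i => J.tieImage u hu (J.tie i)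
      | Gen.f i => J.tieImage u hu (fTie J i) :=
  (RingQuot.liftAlgHom_mkAlgHom_apply R _ _ _).trans (FreeAlgebra.lift_ι_apply _ _)

/-- Each composite fixes the generators; on the Marin side this suffices by
`JuyumayaMap.adjoin_eq_top`. -/
theorem exists_algEquiv :
    ∃ Θ : (J.marinDatum u hu).MarinRing ≃ₐ[R] FloresAlgebra u, ∀ i : Fin n,
      Θ ((J.marinDatum u hu).g i) = FloresAlgebra.g u i ∧
      Θ (J.tieImage u hu (J.tie i)) = FloresAlgebra.e u i ∧
      Θ (J.tieImage u hu (fTie J i)) = FloresAlgebra.f u i := by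
  obtain ⟨Θ, hΘ⟩ := hJ.exists_marinRing_to_floresAlgebra u hu
  have hg : ∀ i, hJ.floresToMarin u hu (FloresAlgebra.g u i) = (J.marinDatum u hu).g i :=
    fun i => hJ.floresToMarin_mk u hu (Gen.g i)
  have he : ∀ i, hJ.floresToMarin u hu (FloresAlgebra.e u i) = J.tieImage u hu (J.tie i) :=
    fun i => hJ.floresToMarin_mk u hu (Gen.e i)
  have hf : ∀ i, hJ.floresToMarin u hu (FloresAlgebra.f u i) = J.tieImage u hu (fTie J i) :=
    fun i => hJ.floresToMarin_mk u hu (Gen.f i)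
  refine ⟨AlgEquiv.ofAlgHom Θ (hJ.floresToMarin u hu) ?_ ?_, hΘ⟩
  · refine RingQuot.ringQuot_ext' R _ _ (FreeAlgebra.hom_ext (funext fun X => ?_))
    change Θ (hJ.floresToMarin u hu (FloresAlgebra.mk u (FreeAlgebra.ι R X))) =
      FloresAlgebra.mk u (FreeAlgebra.ι R X)
    rw [floresToMarin_mk]
    cases X with
    | g i => exact (hΘ i).1
    | e i => exact (hΘ i).2.1
    | f i => exact (hΘ i).2.2
  · refine AlgHom.ext_of_adjoin_eq_top (J.adjoin_eq_top u hu) ?_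
    rintro _ ((⟨i, rfl⟩ | ⟨i, rfl⟩) | ⟨i, rfl⟩)
    · exact (congrArg _ (hΘ i).1).trans (hg i)
    · exact (congrArg _ (hΘ i).2.1).trans (he i)
    · exact (congrArg _ (hΘ i).2.2).trans (hf i)

end IsBtoA

end BraidsTies

end

theorem mainTheorem5 {R : Type*} [CommRing R] {W U : Type*} [Group W] [Group U] (n : ℕ)
    (cs : CoxeterSystem (BraidsTies.typeB n) W)
    (ct : CoxeterSystem (CoxeterMatrix.A n) U) :
    (∃! J : BraidsTies.JuyumayaMap cs ct, BraidsTies.IsBtoA J) ∧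
    ∀ J : BraidsTies.JuyumayaMap cs ct, BraidsTies.IsBtoA J →
      (∀ i : Fin n, J.e i = BraidsTies.rankOne ct i) ∧
      ∀ (u : Fin n → Rˣ)
        (hu : ∀ (g : W) (s t : Fin n), g * cs.simple s * g⁻¹ = cs.simple t → u s = u t),
        Algebra.adjoin R
            (Set.range (fun i : Fin n => (J.marinDatum u hu).g i) ∪
              Set.range (fun i : Fin n => J.tieImage u hu (J.tie i)) ∪
              Set.range (fun i : Fin n => J.tieImage u hu (BraidsTies.fTie J i))) = ⊤ ∧
        ∃ Θ : (J.marinDatum u hu).MarinRing ≃ₐ[R] BraidsTies.FloresAlgebra u,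
          ∀ i : Fin n,
            Θ ((J.marinDatum u hu).g i) = BraidsTies.FloresAlgebra.g u i ∧
            Θ (J.tieImage u hu (J.tie i)) = BraidsTies.FloresAlgebra.e u i ∧
            Θ (J.tieImage u hu (BraidsTies.fTie J i)) = BraidsTies.FloresAlgebra.f u i :=
  ⟨BraidsTies.existsUnique_isBtoA cs ct, fun J hJ => ⟨hJ.e_eq_rankOne, fun u hu =>
    ⟨J.adjoin_eq_top u hu, hJ.exists_algEquiv u hu⟩⟩⟩
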